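/- Let $n\ge 1$ and let $\Omega\subset\mathbb{R}^n$ be a bounded open set with Lipschitz boundary. Let $\gamma_{FV},\gamma_{VS},\gamma_{FS}>0$ be constants such that the Young angle $\theta_e$, defined by $\cos\theta_e=(\gamma_{VS}-\gamma_{FS})/\gamma_{FV}$, lies in $(0,\pi/2)$, put $S=\gamma_{VS}-\gamma_{FS}-\gamma_{FV}$, and let $V>0$. Let $g:\mathbb{R}\to\mathbb{R}$ satisfy (1) $g\in C^1(\mathbb{R})$, $g(0)=-1$ and $\lim_{z\to+\infty}g(z)=0$; (2) $g$ is strictly increasing on $(0,\infty)$ and strictly decreasing on $(-\infty,0)$; (3′) $\lim_{z\to-\infty}g(z)=+\infty$, and $g(z)\le g(-z)$ for all $z>0$. For $\varepsilon>0$ and $h\in L^1(\Omega)$ let $$F^{\varepsilon}(h)=\int_{\Omega}\Big(\gamma_{FV}-S\,g\big(\tfrac{h}{\varepsilon}\big)\Big)\sqrt{1+|\nabla h|^2}\,dx\in[0,+\infty]\quad\text{if } h\in W^{1,1}(\Omega)\text{ and }\int_\Omega h\,dx=V,$$ and $F^\varepsilon(h)=+\infty$ otherwise. Let $\varepsilon_j>0$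 with $\varepsilon_j\to 0$, and let $(h_j)\subset W^{1,1}(\Omega)$ be a sequence such that $\sup_j F^{\varepsilon_j}(h_j)<\infty$. Then there exist a subsequence $(h_{j_k})$ and a function $h\in BV(\Omega)$ such that $h_{j_k}\to h$ in $L^1(\Omega)$; moreover $\int_\Omega h\,dx=V$ and $h\ge 0$ almost everywhere in $\Omega$. -/

import Mathlib

open MeasureTheory Filter Topology Set
open scoped ENNReal NNReal ContDiff

noncomputable section

namespace ThinFilm

/-- `ψ ∈ C_c^∞(Ω)`, the real-valued test functions on the open set `Ω`. -/
def IsTestFunction {n : ℕ} (Ω : Set (EuclideanSpace ℝ (Fin n)))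
    (ψ : EuclideanSpace ℝ (Fin n) → ℝ) : Prop :=
  ContDiff ℝ ∞ ψ ∧ HasCompactSupport ψ ∧ tsupport ψ ⊆ Ω

/-- The `i`-th partial derivative of `ψ` at `x`. -/
def partialDeriv {n : ℕ} (i : Fin n) (ψ : EuclideanSpace ℝ (Fin n) → ℝ)
    (x : EuclideanSpace ℝ (Fin n)) : ℝ :=
  fderiv ℝ ψ x (EuclideanSpace.single i 1)

/-- The boundary of `Ω` is Lipschitz: near each boundary point `x₀` there is a unit direction `ν`
(the vertical direction of a rotated coordinate system) such that `Ω` coincides near `x₀` with the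
strict supergraph `{y : φ(y') < ⟪ν, y⟫}` of a Lipschitz function `φ` of the horizontal part
`y' = y - ⟪ν, y⟫ ν` of `y`. -/
def HasLipschitzBoundary {n : ℕ} (Ω : Set (EuclideanSpace ℝ (Fin n))) : Prop :=
  ∀ x₀ ∈ frontier Ω, ∃ r > 0, ∃ ν : EuclideanSpace ℝ (Fin n), ‖ν‖ = 1 ∧
    ∃ (K : ℝ≥0) (φ : EuclideanSpace ℝ (Fin n) → ℝ), LipschitzWith K φ ∧
      ∀ y ∈ Metric.ball x₀ r, y ∈ Ω ↔ φ (y - inner ℝ ν y • ν) < inner ℝ ν y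

/-- `G` is the weak (distributional) gradient of `u` in `Ω`. -/
def IsWeakGradient {n : ℕ} (Ω : Set (EuclideanSpace ℝ (Fin n)))
    (u : EuclideanSpace ℝ (Fin n) → ℝ)
    (G : EuclideanSpace ℝ (Fin n) → EuclideanSpace ℝ (Fin n)) : Prop :=
  ∀ ψ, IsTestFunction Ω ψ → ∀ i : Fin n,
    ∫ x in Ω, u x * partialDeriv i ψ x = -∫ x in Ω, ψ x * G x i

/-- `u ∈ W^{1,1}(Ω)`. Only the values of `u` on `Ω` matter. -/
def MemW11 {n : ℕ} (Ω : Set (EuclideanSpace ℝ (Fin n)))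
    (u : EuclideanSpace ℝ (Fin n) → ℝ) : Prop :=
  IntegrableOn u Ω ∧
    ∃ G : EuclideanSpace ℝ (Fin n) → EuclideanSpace ℝ (Fin n),
      IntegrableOn G Ω ∧ IsWeakGradient Ω u G

open Classical in
/-- The weak gradient of `u ∈ W^{1,1}(Ω)`; it is unique up to null subsets of `Ω`, see
`ThinFilm.weakGradient_unique`. -/
def weakGradient {n : ℕ} (Ω : Set (EuclideanSpace ℝ (Fin n)))
    (u : EuclideanSpace ℝ (Fin n) → ℝ) :
    EuclideanSpace ℝ (Fin n) → EuclideanSpace ℝ (Fin n) :=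
  if h : ∃ G : EuclideanSpace ℝ (Fin n) → EuclideanSpace ℝ (Fin n),
      IntegrableOn G Ω ∧ IsWeakGradient Ω u G
  then h.choose else 0

theorem weakGradient_unique {n : ℕ} {Ω : Set (EuclideanSpace ℝ (Fin n))} (hΩ : IsOpen Ω)
    {u : EuclideanSpace ℝ (Fin n) → ℝ}
    {G G' : EuclideanSpace ℝ (Fin n) → EuclideanSpace ℝ (Fin n)}
    (hG : IntegrableOn G Ω) (hG' : IntegrableOn G' Ω)
    (h : IsWeakGradient Ω u G) (h' : IsWeakGradient Ω u G') :
    ∀ᵐ x ∂(volume.restrict Ω), G x = G' x := by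
  have coord : ∀ {H : EuclideanSpace ℝ (Fin n) → EuclideanSpace ℝ (Fin n)} (i : Fin n),
      IntegrableOn H Ω → IntegrableOn (fun x => H x i) Ω := fun i hH =>
    (EuclideanSpace.proj i : EuclideanSpace ℝ (Fin n) →L[ℝ] ℝ).integrable_comp hH
  have key : ∀ i : Fin n, ∀ᵐ x ∂(volume.restrict Ω), G x i - G' x i = 0 := by
    intro i
    rw [ae_restrict_iff' hΩ.measurableSet]
    refine hΩ.ae_eq_zero_of_integral_contDiff_smul_eq_zero
      (((coord i hG).sub (coord i hG')).locallyIntegrableOn) ?_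
    intro ψ h1 h2 h3
    have e := (h ψ ⟨h1, h2, h3⟩ i).symm.trans (h' ψ ⟨h1, h2, h3⟩ i)
    have mulInt : ∀ {f : EuclideanSpace ℝ (Fin n) → ℝ}, IntegrableOn f Ω →
        IntegrableOn (fun x => ψ x * f x) Ω := by
      intro f hf
      obtain ⟨C, hC⟩ := h2.exists_bound_of_continuous h1.continuous
      exact Integrable.bdd_mul hf h1.continuous.aestronglyMeasurable (ae_of_all _ hC)
    have e2 : ∫ x in Ω, ψ x * (G x i - G' x i) = 0 := by
      simp only [mul_sub]
      rw [integral_sub (mulInt (coord i hG)) (mulInt (coord i hG'))]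
      linarith
    rw [← e2]
    symm
    apply setIntegral_eq_integral_of_forall_compl_eq_zero
    intro x hx
    have : ψ x = 0 := image_eq_zero_of_notMem_tsupport (fun hx' => hx (h3 hx'))
    simp [this]
  filter_upwards [ae_all_iff.2 key] with x hx
  ext i
  exact sub_eq_zero.1 (hx i)

/-- `u ∈ BV(Ω)`: `u ∈ L¹(Ω)` and its distributional derivative in `Ω` is represented by an
`ℝⁿ`-valued finite measure `Du = (D₁u, …, Dₙu)`. -/
def MemBV {n : ℕ} (Ω : Set (EuclideanSpace ℝ (Fin n)))
    (u : EuclideanSpace ℝ (Fin n) → ℝ) : Prop :=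
  IntegrableOn u Ω ∧
    ∃ D : Fin n → SignedMeasure (EuclideanSpace ℝ (Fin n)),
      ∀ ψ, IsTestFunction Ω ψ → ∀ i : Fin n,
        ∫ x in Ω, u x * partialDeriv i ψ x = -∫ᵛ x in Ω, ψ x ∂<•(D i)

/-- The spreading parameter `S = γ_VS - γ_FS - γ_FV`. -/
def spreading (γFV γVS γFS : ℝ) : ℝ := γVS - γFS - γFV

/-- The regularized surface energy density `γ^ε(s) = γ_FV - S g(s / ε)`. -/
def density (γFV γVS γFS : ℝ) (g : ℝ → ℝ) (ε s : ℝ) : ℝ :=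
  γFV - spreading γFV γVS γFS * g (s / ε)

open Classical in
/-- The regularized energy `F^ε(h) = ∫_Ω γ^ε(h) √(1 + |∇h|²)` if `h ∈ W^{1,1}(Ω)` and
`∫_Ω h = V`, and `+∞` otherwise. The integrand is positive for the parameters of the model
(`S < 0`, `g ≥ -1` and `γ_FV + S > 0`), so that the integral is taken in `[0, ∞]`. -/
def energy {n : ℕ} (Ω : Set (EuclideanSpace ℝ (Fin n))) (γFV γVS γFS V : ℝ) (g : ℝ → ℝ) (ε : ℝ)
    (h : EuclideanSpace ℝ (Fin n) → ℝ) : ℝ≥0∞ :=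
  if MemW11 Ω h ∧ ∫ x in Ω, h x = V then
    ∫⁻ x in Ω, ENNReal.ofReal
      (density γFV γVS γFS g ε (h x) * Real.sqrt (1 + ‖weakGradient Ω h x‖ ^ 2))
  else ⊤

/-- The conditions on the interpolation function `g`. -/
structure IsInterpolation (g : ℝ → ℝ) : Prop where
  contDiff : ContDiff ℝ 1 g
  map_zero : g 0 = -1
  tendsto_atTop : Tendsto g atTop (𝓝 0)
  strictMonoOn : StrictMonoOn g (Ioi 0)
  strictAntiOn : StrictAntiOn g (Iio 0)
  tendsto_atBot : Tendsto g atBot atTop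
  le_reflect : ∀ z : ℝ, 0 < z → g z ≤ g (-z)

end ThinFilm

end

/-!
The density `γ_FV - S g(h/ε)` is at least `γ_FV + S = γ_VS - γ_FS > 0`, because `S < 0` and
`g ≥ -1`. Hence bounded energy bounds `∫_Ω |∇h_j|`. Moreover the density exceeds any constant on
`{h_j < -δ}` for large `j`, because `ε_j → 0` and `g → +∞` at `-∞`; so `|{h_j < -δ}| → 0`
(`tendsto_measure_sublevel`). What remains is a Rellich theorem on Lipschitz domains, together with
an `L¹` bound; a Poincaré inequality is not available, as `Ω` may be disconnected.

Both rest on one estimate. If the segments `x + [0,1] w`, `x ∈ A`, stay in `Ω`, then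
`∫_A |u(x + w) - u(x)| dx ≤ |w| ∫_Ω |∇u|`, by duality with test functions
(`IsWeakGradient.lintegral_enorm_translate_sub_le`). Near every point of `closure Ω` there is a cone
of admissible directions `w`: small balls around `t v` for small `t` (`HasUniformCone`). Since
`closure Ω` is compact, it suffices to argue on each piece `A = Ω ∩ ball x₀ r`.

* The `L¹` bound. The function `min h_j 0` has the same increments bound as `h_j` and is at least
  `-1` outside a set of small measure. So each value `min h_j 0` at `x` can be compared with its
  values at most of the points `x + w`, which bounds `∫_A |min h_j 0|`
  (`lintegral_enorm_le_of_measure_superlevel_le`). Together with `∫_Ω h_j = V` this bounds `h_j`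
  in `L¹(Ω)`.
* Compactness. The increments bound compares `u`, up to `O(t)` in `L¹(A)`, with its averages over
  balls of radius `c t / 2` with centres in a countable set. All these countably many averages
  converge along a common subsequence, which is then Cauchy in `L¹(A)`
  (`exists_subseq_isL1CauchyOn`).

The `L¹` limit belongs to `BV(Ω)`: the positive and negative parts of the components of `∇h_j`
converge weakly-* along an ultrafilter, and the Riesz–Markov–Kakutani theorem represents the limits
by measures (`memBV_of_tendsto`). It is nonnegative because `|{h_j < -δ}| → 0` for every `δ > 0`.
-/

namespace ThinFilm

variable {n : ℕ}

/-! ### Duality between `L¹` and test functions -/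

/-- The version on compact subsets: the test functions are mollifications of the sign of `f`,
cut off outside `K`. -/
lemma lintegral_enorm_le_of_isCompact {A K : Set (EuclideanSpace ℝ (Fin n))} (hA : IsOpen A)
    (hK : IsCompact K) (hKA : K ⊆ A) {f : EuclideanSpace ℝ (Fin n) → ℝ} (hf : IntegrableOn f A)
    {M : ℝ} (h : ∀ ψ, IsTestFunction A ψ → (∀ x, |ψ x| ≤ 1) → ∫ x in A, f x * ψ x ≤ M) :
    ∫⁻ x in K, ‖f x‖ₑ ≤ ENNReal.ofReal M := by
  obtain ⟨δ, hδ, hδA⟩ := hK.exists_cthickening_subset_open hA hKA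
  set g : EuclideanSpace ℝ (Fin n) → ℝ :=
    K.indicator (fun x => if 0 ≤ f x then 1 else -1) with hg
  have hg1 : ∀ x, |g x| ≤ 1 := by
    intro x
    simp only [hg, indicator]
    split_ifs <;> norm_num
  have hgm : AEStronglyMeasurable g volume := by
    rw [hg, aestronglyMeasurable_indicator_iff hK.measurableSet]
    have h1 : Measurable (fun y : ℝ => if 0 ≤ y then (1 : ℝ) else -1) :=
      Measurable.ite measurableSet_Ici measurable_const measurable_const
    exact (h1.comp_aemeasurable (hf.mono_set hKA).aemeasurable).aestronglyMeasurable
  have hgi : Integrable g volume := by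
    rw [← integrableOn_iff_integrable_of_support_subset (s := K) support_indicator_subset]
    exact Measure.integrableOn_of_bounded hK.measure_lt_top.ne hgm (ae_of_all _ hg1)
  -- radii at most `δ` keep the mollified functions supported in `A`
  let φ : ℕ → ContDiffBump (0 : EuclideanSpace ℝ (Fin n)) := fun k =>
    ⟨δ / 2 / (k + 2), δ / (k + 2), by positivity, by gcongr; linarith⟩
  have hφ : ∀ k, (φ k).rOut ≤ δ := fun k => by
    change δ / (k + 2 : ℝ) ≤ δ
    exact div_le_self hδ.le (by linarith [(Nat.cast_nonneg k : (0 : ℝ) ≤ k)])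
  let ψ : ℕ → EuclideanSpace ℝ (Fin n) → ℝ := fun k =>
    convolution ((φ k).normed volume) g (ContinuousLinearMap.lsmul ℝ ℝ) volume
  have hψsupp : ∀ k, Function.support (ψ k) ⊆ Metric.cthickening δ K := by
    intro k
    refine (support_convolution_subset _).trans ?_
    rintro _ ⟨a, ha, b, hb, rfl⟩
    rw [ContDiffBump.support_normed_eq, mem_ball_zero_iff] at ha
    have hbK : b ∈ K := support_indicator_subset hb
    refine Metric.mem_cthickening_of_dist_le _ b δ K hbK ?_
    rw [dist_eq_norm]
    simpa using ha.le.trans (hφ k)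
  have hψt : ∀ k, tsupport (ψ k) ⊆ Metric.cthickening δ K := fun k =>
    closure_minimal (hψsupp k) Metric.isClosed_cthickening
  have hψ : ∀ k, IsTestFunction A (ψ k) := by
    intro k
    refine ⟨?_, ?_, (hψt k).trans hδA⟩
    · exact (φ k).hasCompactSupport_normed.contDiff_convolution_left _ (φ k).contDiff_normed
        hgi.locallyIntegrable
    · exact HasCompactSupport.of_support_subset_isCompact hK.cthickening (hψsupp k)
  have hψ1 : ∀ k x, |ψ k x| ≤ 1 := by
    intro k x
    have := dist_convolution_le (μ := volume) (z₀ := (0 : ℝ)) (x₀ := x) zero_le_one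
      (φ k).support_normed_eq.subset (φ k).nonneg_normed (φ k).integral_normed hgm
      fun y _ => by simpa using hg1 y
    simpa using this
  have hlim : ∀ᵐ x, Tendsto (fun k => ψ k x) atTop (𝓝 (g x)) := by
    apply ContDiffBump.ae_convolution_tendsto_right_of_locallyIntegrable (K := 2)
    · change Tendsto (fun k : ℕ => δ / ((k : ℝ) + 2)) atTop (𝓝 0)
      exact tendsto_const_nhds.div_atTop
        (tendsto_atTop_add_const_right _ _ tendsto_natCast_atTop_atTop)
    · refine Eventually.of_forall fun k => ?_
      change δ / (k + 2 : ℝ) ≤ 2 * (δ / 2 / (k + 2))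
      apply le_of_eq
      ring
    · exact hgi.locallyIntegrable
  have hT : Tendsto (fun k => ∫ x in A, f x * ψ k x) atTop (𝓝 (∫ x in A, f x * g x)) := by
    apply tendsto_integral_of_dominated_convergence (fun x => ‖f x‖)
    · intro k
      exact hf.aestronglyMeasurable.mul (hψ k).1.continuous.aestronglyMeasurable
    · exact hf.norm
    · intro k
      refine ae_of_all _ fun x => ?_
      rw [norm_mul]
      exact mul_le_of_le_one_right (norm_nonneg _) (hψ1 k x)
    · filter_upwards [ae_restrict_of_ae hlim] with x hx
      exact hx.const_mul _
  have hle : ∫ x in A, f x * g x ≤ M :=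
    le_of_tendsto hT (Eventually.of_forall fun k => h _ (hψ k) (hψ1 k))
  have hfg : (fun x => f x * g x) = K.indicator (fun x => ‖f x‖) := by
    funext x
    simp only [hg, indicator]
    split_ifs with h1 h2
    · simp [abs_of_nonneg h2]
    · simp [abs_of_neg (not_le.1 h2)]
    · simp
  rw [hfg, setIntegral_indicator hK.measurableSet, inter_eq_self_of_subset_right hKA] at hle
  rw [← ofReal_integral_norm_eq_lintegral_enorm (hf.mono_set hKA)]
  exact ENNReal.ofReal_le_ofReal hle

/-- The `L¹` norm of `f` on an open set is controlled by testing `f` against smooth compactly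
supported functions bounded by `1`. -/
lemma lintegral_enorm_le_of_forall_testFunction {A : Set (EuclideanSpace ℝ (Fin n))}
    (hA : IsOpen A) {f : EuclideanSpace ℝ (Fin n) → ℝ} (hf : IntegrableOn f A)
    {M : ℝ} (h : ∀ ψ, IsTestFunction A ψ → (∀ x, |ψ x| ≤ 1) → ∫ x in A, f x * ψ x ≤ M) :
    ∫⁻ x in A, ‖f x‖ₑ ≤ ENNReal.ofReal M := by
  obtain ⟨F, hFc, hFA, hFU, hFm⟩ := hA.exists_iUnion_isClosed
  have hm : Monotone fun k : ℕ => F k ∩ Metric.closedBall 0 (k : ℝ) := fun i j hij =>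
    inter_subset_inter (hFm hij) (Metric.closedBall_subset_closedBall (by exact_mod_cast hij))
  have hU : A = ⋃ k : ℕ, F k ∩ Metric.closedBall 0 (k : ℝ) := by
    apply Subset.antisymm
    · intro x hx
      rw [← hFU] at hx
      obtain ⟨i, hi⟩ := mem_iUnion.1 hx
      obtain ⟨j, hj⟩ := exists_nat_ge ‖x‖
      refine mem_iUnion.2 ⟨max i j, hFm (le_max_left _ _) hi, ?_⟩
      rw [mem_closedBall_zero_iff]
      exact hj.trans (by exact_mod_cast le_max_right i j)
    · exact iUnion_subset fun k => inter_subset_left.trans (hFA k)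
  conv_lhs => rw [hU]
  rw [setLIntegral_iUnion_of_directed _ hm.directed_le]
  exact iSup_le fun k => lintegral_enorm_le_of_isCompact hA
    ((isCompact_closedBall _ _).inter_left (hFc k)) (inter_subset_left.trans (hFA k)) hf h

/-! ### Increments of functions with a weak gradient -/

lemma IsTestFunction.bounded {Ω : Set (EuclideanSpace ℝ (Fin n))}
    {ψ : EuclideanSpace ℝ (Fin n) → ℝ} (hψ : IsTestFunction Ω ψ) : ∃ C, ∀ x, ‖ψ x‖ ≤ C :=
  hψ.2.1.exists_bound_of_continuous hψ.1.continuous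

lemma IsTestFunction.comp_sub_right {A Ω : Set (EuclideanSpace ℝ (Fin n))}
    {ψ : EuclideanSpace ℝ (Fin n) → ℝ} (hψ : IsTestFunction A ψ) {w : EuclideanSpace ℝ (Fin n)}
    (hw : ∀ x ∈ A, x + w ∈ Ω) : IsTestFunction Ω (fun x => ψ (x - w)) := by
  have e : (fun x => ψ (x - w)) = ψ ∘ (Homeomorph.subRight w) := rfl
  refine ⟨hψ.1.comp (contDiff_id.sub contDiff_const), ?_, ?_⟩
  · rw [e]
    exact hψ.2.1.comp_homeomorph _
  · rw [e, tsupport_comp_eq_preimage]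
    intro x hx
    simpa using hw _ (hψ.2.2 hx)

lemma fderiv_eq_sum_partialDeriv (ψ : EuclideanSpace ℝ (Fin n) → ℝ)
    (x w : EuclideanSpace ℝ (Fin n)) : fderiv ℝ ψ x w = ∑ i, w i * partialDeriv i ψ x := by
  have hw : w = ∑ i, w i • EuclideanSpace.single i (1 : ℝ) := by
    ext j
    simp [Finset.sum_apply, Pi.single_apply]
  conv_lhs => rw [hw]
  simp [partialDeriv]

/-- Integration by parts in the direction `w`. -/
lemma IsWeakGradient.integral_mul_fderiv {Ω : Set (EuclideanSpace ℝ (Fin n))}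
    {u : EuclideanSpace ℝ (Fin n) → ℝ}
    {G : EuclideanSpace ℝ (Fin n) → EuclideanSpace ℝ (Fin n)}
    (hu : IntegrableOn u Ω) (hG : IntegrableOn G Ω) (h : IsWeakGradient Ω u G)
    {ψ : EuclideanSpace ℝ (Fin n) → ℝ} (hψ : IsTestFunction Ω ψ)
    (w : EuclideanSpace ℝ (Fin n)) :
    ∫ x in Ω, u x * fderiv ℝ ψ x w = -∫ x in Ω, ψ x * inner ℝ w (G x) := by
  obtain ⟨C, hC⟩ := hψ.bounded
  have hcd : Continuous (fderiv ℝ ψ) := hψ.1.continuous_fderiv (by simp)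
  obtain ⟨C', hC'⟩ := (hψ.2.1.fderiv ℝ).exists_bound_of_continuous hcd
  have i1 : ∀ i, Integrable (fun x => u x * (w i * partialDeriv i ψ x)) (volume.restrict Ω) := by
    intro i
    refine Integrable.mul_bdd (c := |w i| * C') hu ?_ (ae_of_all _ fun x => ?_)
    · exact (continuous_const.mul (hcd.clm_apply continuous_const)).aestronglyMeasurable
    · rw [norm_mul, Real.norm_eq_abs]
      gcongr
      refine ((fderiv ℝ ψ x).le_opNorm _).trans ?_
      simpa using hC' x
  have i2 : ∀ i, Integrable (fun x => ψ x * (w i * G x i)) (volume.restrict Ω) := by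
    intro i
    refine Integrable.bdd_mul (c := C) ?_ hψ.1.continuous.aestronglyMeasurable (ae_of_all _ hC)
    exact ((EuclideanSpace.proj i : EuclideanSpace ℝ (Fin n) →L[ℝ] ℝ).integrable_comp
      hG).const_mul _
  have e1 : ∀ x, inner ℝ w (G x) = ∑ i, w i * G x i := fun x => by
    simp [PiLp.inner_apply, mul_comm]
  simp_rw [fderiv_eq_sum_partialDeriv, e1, Finset.mul_sum]
  rw [integral_finsetSum _ fun i _ => i1 i, integral_finsetSum _ fun i _ => i2 i,
    ← Finset.sum_neg_distrib]
  refine Finset.sum_congr rfl fun i _ => ?_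
  have := h ψ hψ i
  simp_rw [mul_left_comm _ (w i), integral_const_mul, this]
  ring

/-- Increments of `u` in the direction `w` are controlled by the weak gradient, on any
open set whose segments in the direction `w` stay in `Ω`. -/
lemma IsWeakGradient.lintegral_enorm_translate_sub_le {A Ω : Set (EuclideanSpace ℝ (Fin n))}
    (hA : IsOpen A) {u : EuclideanSpace ℝ (Fin n) → ℝ} (hu : Integrable u)
    {G : EuclideanSpace ℝ (Fin n) → EuclideanSpace ℝ (Fin n)} (hG : IntegrableOn G Ω)
    (h : IsWeakGradient Ω u G) {w : EuclideanSpace ℝ (Fin n)}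
    (hw : ∀ x ∈ A, ∀ s ∈ Icc (0 : ℝ) 1, x + s • w ∈ Ω) :
    ∫⁻ x in A, ‖u (x + w) - u x‖ₑ ≤ ENNReal.ofReal (‖w‖ * ∫ x in Ω, ‖G x‖) := by
  have hAΩ : A ⊆ Ω := fun x hx => by simpa using hw x hx 0 (by simp)
  have hAw : ∀ x ∈ A, x + w ∈ Ω := fun x hx => by simpa using hw x hx 1 (by simp)
  have huw : Integrable (fun x => u (x + w)) := hu.comp_add_right w
  refine lintegral_enorm_le_of_forall_testFunction (f := fun x => u (x + w) - u x) hA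
    (huw.sub hu).integrableOn ?_
  intro ψ hψ hψ1
  have hcd : Continuous (fderiv ℝ ψ) := hψ.1.continuous_fderiv (by simp)
  obtain ⟨C', hC'⟩ := (hψ.2.1.fderiv ℝ).exists_bound_of_continuous hcd
  have hψs : ∀ s ∈ Icc (0 : ℝ) 1, IsTestFunction Ω (fun x => ψ (x - s • w)) := fun s hs =>
    hψ.comp_sub_right fun x hx => hw x hx s hs
  have hmul : ∀ v : EuclideanSpace ℝ (Fin n), Integrable (fun x => u x * ψ (x - v)) := fun v =>
    Integrable.mul_bdd (c := 1) hu
      (hψ.1.continuous.comp (continuous_id.sub continuous_const)).aestronglyMeasurable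
      (ae_of_all _ fun x => hψ1 _)
  -- the derivative of `s ↦ ∫ u ψ(· - s w)`
  have hderiv : ∀ s : ℝ, HasDerivAt (fun s : ℝ => ∫ x in Ω, u x * ψ (x - s • w))
      (∫ x in Ω, u x * -(fderiv ℝ ψ (x - s • w) w)) s := by
    intro s
    refine (hasDerivAt_integral_of_dominated_loc_of_deriv_le (s := univ)
      (bound := fun x => ‖u x‖ * (C' * ‖w‖)) (F' := fun s x => u x * -(fderiv ℝ ψ (x - s • w) w))
      univ_mem ?_ ?_ ?_ ?_ ?_ ?_).2
    · exact Eventually.of_forall fun s => (hmul _).integrableOn.aestronglyMeasurable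
    · exact (hmul _).integrableOn
    · refine hu.integrableOn.aestronglyMeasurable.mul (Continuous.aestronglyMeasurable ?_)
      exact ((hcd.comp (continuous_id.sub continuous_const)).clm_apply continuous_const).neg
    · refine ae_of_all _ fun x s _ => ?_
      rw [norm_mul, norm_neg]
      gcongr
      exact (ContinuousLinearMap.le_opNorm _ _).trans
        (mul_le_mul_of_nonneg_right (hC' _) (norm_nonneg _))
    · exact hu.integrableOn.norm.mul_const _
    · refine ae_of_all _ fun x s _ => ?_
      have h1 : HasDerivAt (fun s : ℝ => x - s • w) (-w) s := by
        simpa using ((hasDerivAt_id s).smul_const w).const_sub x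
      have h2 := ((hψ.1.differentiable (by simp)) (x - s • w)).hasFDerivAt.comp_hasDerivAt s h1
      simpa using h2.const_mul (u x)
  have hbound : ∀ s ∈ Icc (0 : ℝ) 1,
      ‖∫ x in Ω, u x * -(fderiv ℝ ψ (x - s • w) w)‖ ≤ ‖w‖ * ∫ x in Ω, ‖G x‖ := by
    intro s hs
    have e := h.integral_mul_fderiv hu.integrableOn hG (hψs s hs) w
    simp_rw [fderiv_comp_sub] at e
    simp_rw [mul_neg, integral_neg]
    rw [e, neg_neg, ← integral_const_mul]
    refine norm_integral_le_of_norm_le (hG.norm.const_mul _) (ae_of_all _ fun x => ?_)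
    rw [norm_mul]
    calc ‖ψ (x - s • w)‖ * ‖inner ℝ w (G x)‖ ≤ 1 * (‖w‖ * ‖G x‖) := by
          gcongr
          · exact hψ1 _
          · exact norm_inner_le_norm _ _
      _ = _ := one_mul _
  have hmv := norm_image_sub_le_of_norm_deriv_le_segment_01'
    (fun s _ => (hderiv s).hasDerivWithinAt) (fun s hs => hbound s (Ico_subset_Icc_self hs))
  refine le_trans (le_of_eq ?_) ((le_abs_self _).trans hmv)
  have full : ∀ {B : Set (EuclideanSpace ℝ (Fin n))} {f η : EuclideanSpace ℝ (Fin n) → ℝ},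
      IsTestFunction B η → ∫ x in B, f x * η x = ∫ x, f x * η x := fun hη =>
    setIntegral_eq_integral_of_forall_compl_eq_zero fun x hx => by
      rw [image_eq_zero_of_notMem_tsupport fun h' => hx (hη.2.2 h'), mul_zero]
  have hs0 := hψs 0 (by simp)
  have hs1 := hψs 1 (by simp)
  rw [full hψ, full hs0, full hs1]
  simp only [one_smul, zero_smul, sub_zero]
  rw [← integral_add_right_eq_self (fun x => u x * ψ (x - w)) w]
  simp only [add_sub_cancel_right, sub_mul]
  refine integral_sub ?_ ?_
  · simpa using (hmul w).comp_add_right w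
  · simpa using hmul 0

/-! ### The uniform cone property of Lipschitz domains -/

/-- `Ω` contains truncated cones with apex at its points near `x₀`, all with the same
axis direction `v` and opening: `x + w ∈ Ω` for `w` in the ball of radius `c t` around `t v`, for
all `0 < t ≤ T`. The axis vector `v` is not normalized and may be `0`, as for interior points `x₀`. -/
def HasUniformCone (Ω : Set (EuclideanSpace ℝ (Fin n))) (x₀ : EuclideanSpace ℝ (Fin n)) : Prop :=
  ∃ r > 0, ∃ (v : EuclideanSpace ℝ (Fin n)), ∃ c > 0, ∃ T > 0, ∀ x ∈ Ω ∩ Metric.ball x₀ r,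
    ∀ t ∈ Ioc (0 : ℝ) T, ∀ w ∈ Metric.closedBall (t • v) (c * t), x + w ∈ Ω

lemma HasLipschitzBoundary.hasUniformCone {Ω : Set (EuclideanSpace ℝ (Fin n))} (hΩ : IsOpen Ω)
    (hL : HasLipschitzBoundary Ω) {x₀ : EuclideanSpace ℝ (Fin n)} (hx₀ : x₀ ∈ closure Ω) :
    HasUniformCone Ω x₀ := by
  by_cases hxΩ : x₀ ∈ Ω
  · obtain ⟨r, hr, hrΩ⟩ := Metric.isOpen_iff.1 hΩ x₀ hxΩ
    refine ⟨r / 2, by positivity, 0, 1, one_pos, r / 2, by positivity, ?_⟩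
    intro x hx t ht w hw
    apply hrΩ
    have h1 := hx.2
    rw [Metric.mem_ball, dist_eq_norm] at h1 ⊢
    simp only [smul_zero, one_mul, mem_closedBall_zero_iff] at hw
    have : ‖x + w - x₀‖ ≤ ‖x - x₀‖ + ‖w‖ := by
      rw [add_sub_right_comm]
      exact norm_add_le _ _
    linarith [ht.2]
  · have hfr : x₀ ∈ frontier Ω := by
      rw [hΩ.frontier_eq]
      exact ⟨hx₀, hxΩ⟩
    obtain ⟨r, hr, ν, hν, K, φ, hφ, hiff⟩ := hL x₀ hfr
    have hK : (0 : ℝ) ≤ K := K.2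
    -- with the opening `c = 1 / (2 (K + 1))`, moving by `w` with `|w - t ν| ≤ c t` raises the height
    -- by at least `t - c t`, and the graph of `φ` by at most `K c t = t / 2 - c t`
    have hc : (0 : ℝ) < 1 / (2 * (K + 1)) := by positivity
    have hc' : (1 : ℝ) / (2 * (K + 1)) ≤ 1 / 2 := by
      apply one_div_le_one_div_of_le two_pos
      linarith
    have hcK : 1 / (2 * (K + 1)) * ((K : ℝ) + 1) = 1 / 2 := by
      field_simp
    refine ⟨r / 2, by positivity, ν, _, hc, r / 4, by positivity, ?_⟩
    set c : ℝ := 1 / (2 * (K + 1))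
    intro x hx t ht w hw
    have hw' : ‖w - t • ν‖ ≤ c * t := by rwa [Metric.mem_closedBall, dist_eq_norm] at hw
    set z := w - t • ν with hz
    have hwz : w = t • ν + z := by rw [hz]; abel
    have h1 := hx.2
    rw [Metric.mem_ball, dist_eq_norm] at h1
    have hct : c * t ≤ t / 2 := by nlinarith [ht.1]
    have hball : x + w ∈ Metric.ball x₀ r := by
      rw [Metric.mem_ball, dist_eq_norm]
      have e1 : ‖x + w - x₀‖ ≤ ‖x - x₀‖ + (‖t • ν‖ + ‖z‖) := by
        rw [hwz, add_sub_right_comm]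
        exact (norm_add_le _ _).trans (by gcongr; exact norm_add_le _ _)
      rw [norm_smul, hν, Real.norm_of_nonneg ht.1.le] at e1
      linarith [ht.2]
    have hxb : x ∈ Metric.ball x₀ r := Metric.ball_subset_ball (by linarith) hx.2
    have hin := (hiff x hxb).1 hx.1
    refine (hiff _ hball).2 ?_
    have hinner : inner ℝ ν (x + w) = inner ℝ ν x + t + inner ℝ ν z := by
      rw [hwz, inner_add_right, inner_add_right, inner_smul_right, real_inner_self_eq_norm_sq, hν]
      ring
    have hz1 : |inner ℝ ν z| ≤ c * t := by
      have := abs_real_inner_le_norm ν z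
      rw [hν, one_mul] at this
      exact this.trans hw'
    have hhor : ‖z - inner ℝ ν z • ν‖ ≤ c * t := by
      have e : ‖z - inner ℝ ν z • ν‖ ^ 2 = ‖z‖ ^ 2 - inner ℝ ν z ^ 2 := by
        rw [norm_sub_sq_real, inner_smul_right, norm_smul, hν, real_inner_comm,
          Real.norm_eq_abs, mul_one, sq_abs]
        ring
      have : ‖z - inner ℝ ν z • ν‖ ≤ ‖z‖ :=
        le_of_sq_le_sq (by rw [e]; linarith [sq_nonneg (inner ℝ ν z)]) (norm_nonneg _)
      exact this.trans hw'
    have hφ' := hφ.dist_le_mul (x + w - inner ℝ ν (x + w) • ν) (x - inner ℝ ν x • ν)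
    have hdiff : x + w - inner ℝ ν (x + w) • ν - (x - inner ℝ ν x • ν)
        = z - inner ℝ ν z • ν := by
      rw [hinner, hwz]
      simp only [add_smul]
      abel
    rw [dist_eq_norm, dist_eq_norm, hdiff, Real.norm_eq_abs] at hφ'
    have h3 := (le_abs_self _).trans (hφ'.trans (mul_le_mul_of_nonneg_left hhor hK))
    have h4 := neg_abs_le (inner ℝ ν z)
    have h5 : K * (c * t) + c * t = t / 2 := by
      linear_combination t * hcK
    linarith [ht.1, hinner]

/-! ### Increments in the directions of a cone -/

lemma IsWeakGradient.lintegral_enorm_translate_sub_le_of_cone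
    {Ω : Set (EuclideanSpace ℝ (Fin n))} (hΩ : IsOpen Ω)
    {x₀ v : EuclideanSpace ℝ (Fin n)} {r c T : ℝ}
    (hcone : ∀ x ∈ Ω ∩ Metric.ball x₀ r, ∀ t ∈ Ioc (0 : ℝ) T,
      ∀ w ∈ Metric.closedBall (t • v) (c * t), x + w ∈ Ω)
    {u : EuclideanSpace ℝ (Fin n) → ℝ} (hu : Integrable u)
    {G : EuclideanSpace ℝ (Fin n) → EuclideanSpace ℝ (Fin n)} (hG : IntegrableOn G Ω)
    (h : IsWeakGradient Ω u G) {t : ℝ} (ht : t ∈ Ioc 0 T) {w : EuclideanSpace ℝ (Fin n)}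
    (hw : w ∈ Metric.closedBall (t • v) (c * t)) :
    ∫⁻ x in Ω ∩ Metric.ball x₀ r, ‖u (x + w) - u x‖ₑ
      ≤ ENNReal.ofReal (t * ((‖v‖ + c) * ∫ x in Ω, ‖G x‖)) := by
  refine (h.lintegral_enorm_translate_sub_le (hΩ.inter Metric.isOpen_ball) hu hG ?_).trans ?_
  · intro x hx s hs
    rcases hs.1.eq_or_lt with rfl | hs0
    · simpa using hx.1
    · refine hcone x hx (s * t) ⟨mul_pos hs0 ht.1, ?_⟩ _ ?_
      · exact (mul_le_of_le_one_left ht.1.le hs.2).trans ht.2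
      · rw [Metric.mem_closedBall, dist_eq_norm] at hw ⊢
        rw [mul_smul, ← smul_sub, norm_smul, Real.norm_of_nonneg hs.1, mul_left_comm]
        exact mul_le_mul_of_nonneg_left hw hs.1
  · apply ENNReal.ofReal_le_ofReal
    rw [← mul_assoc]
    refine mul_le_mul_of_nonneg_right ?_ (integral_nonneg fun _ => norm_nonneg _)
    rw [Metric.mem_closedBall, dist_eq_norm] at hw
    have h1 : ‖w‖ ≤ ‖w - t • v‖ + ‖t • v‖ := by
      simpa using norm_add_le (w - t • v) (t • v)
    rw [norm_smul, Real.norm_of_nonneg ht.1.le] at h1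
    linarith

lemma measurable_enorm_translate_sub {f : EuclideanSpace ℝ (Fin n) → ℝ} (hf : Measurable f) :
    Measurable (fun z : EuclideanSpace ℝ (Fin n) × EuclideanSpace ℝ (Fin n) =>
      ‖f (z.1 + z.2) - f z.1‖ₑ) := by
  fun_prop

lemma lintegral_lintegral_translate_le {A B : Set (EuclideanSpace ℝ (Fin n))}
    (hB : MeasurableSet B) {f : EuclideanSpace ℝ (Fin n) → ℝ} (hf : Measurable f) {S : ℝ≥0∞}
    (hS : ∀ w ∈ B, ∫⁻ x in A, ‖f (x + w) - f x‖ₑ ≤ S) :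
    ∫⁻ x in A, ∫⁻ w in B, ‖f (x + w) - f x‖ₑ ≤ S * volume B := by
  rw [lintegral_lintegral_swap (measurable_enorm_translate_sub hf).aemeasurable]
  calc ∫⁻ w in B, ∫⁻ x in A, ‖f (x + w) - f x‖ₑ ≤ ∫⁻ _ in B, S := setLIntegral_mono' hB hS
    _ = S * volume B := by simp

/-- A function with bounded increments which is at most `1` in absolute value on most of `Ω` has a
bounded integral: each value is compared with the values at most of the points of `x + B`. -/
lemma lintegral_enorm_le_of_measure_superlevel_le {A B Ω : Set (EuclideanSpace ℝ (Fin n))}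
    (hA : MeasurableSet A) (hB : MeasurableSet B) (hB0 : volume B ≠ 0) (hBt : volume B ≠ ⊤)
    (hAB : ∀ x ∈ A, ∀ w ∈ B, x + w ∈ Ω)
    {f : EuclideanSpace ℝ (Fin n) → ℝ} (hf : Measurable f) {S : ℝ≥0∞}
    (hS : ∀ w ∈ B, ∫⁻ x in A, ‖f (x + w) - f x‖ₑ ≤ S)
    (hlevel : volume {x ∈ Ω | 1 < ‖f x‖ₑ} ≤ volume B / 2) :
    ∫⁻ x in A, ‖f x‖ₑ ≤ 2 * (S + volume A) := by
  have hpt : ∀ x ∈ A, ‖f x‖ₑ * (volume B / 2)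
      ≤ (∫⁻ w in B, ‖f (x + w) - f x‖ₑ) + volume B := by
    intro x hx
    set W : Set (EuclideanSpace ℝ (Fin n)) := {w ∈ B | ‖f (x + w)‖ₑ ≤ 1} with hW
    have hWm : MeasurableSet W :=
      hB.inter (measurableSet_le (hf.comp (measurable_const_add x)).enorm measurable_const)
    have hWc : volume B / 2 ≤ volume W := by
      have hsub : B ⊆ W ∪ (fun w => x + w) ⁻¹' {x ∈ Ω | 1 < ‖f x‖ₑ} := by
        intro w hw
        by_cases h1 : ‖f (x + w)‖ₑ ≤ 1
        · exact Or.inl ⟨hw, h1⟩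
        · exact Or.inr ⟨hAB x hx w hw, not_le.1 h1⟩
      have h2 := (measure_mono (μ := volume) hsub).trans (measure_union_le _ _)
      rw [measure_preimage_add] at h2
      have h3 : volume B / 2 + volume B / 2 ≤ volume W + volume B / 2 := by
        rw [ENNReal.add_halves]
        exact h2.trans (by gcongr)
      exact (ENNReal.add_le_add_iff_right (ENNReal.div_ne_top hBt two_ne_zero)).1 h3
    calc ‖f x‖ₑ * (volume B / 2) ≤ ‖f x‖ₑ * volume W := by gcongr
      _ = ∫⁻ _ in W, ‖f x‖ₑ := by simp
      _ ≤ ∫⁻ w in W, (‖f (x + w) - f x‖ₑ + 1) := by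
          refine setLIntegral_mono' hWm fun w hw => ?_
          have h1 : ‖f x‖ₑ ≤ ‖f (x + w)‖ₑ + ‖f (x + w) - f x‖ₑ := by
            simpa using enorm_sub_le (a := f (x + w)) (b := f (x + w) - f x)
          rw [add_comm]
          exact h1.trans (by gcongr; exact hw.2)
      _ ≤ ∫⁻ w in B, (‖f (x + w) - f x‖ₑ + 1) := lintegral_mono_set fun w hw => hw.1
      _ = _ := by
          rw [lintegral_add_right _ measurable_const]
          simp
  have h1 : (∫⁻ x in A, ‖f x‖ₑ) * (volume B / 2) ≤ 2 * (S + volume A) * (volume B / 2) := by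
    calc (∫⁻ x in A, ‖f x‖ₑ) * (volume B / 2) = ∫⁻ x in A, ‖f x‖ₑ * (volume B / 2) :=
          (lintegral_mul_const _ hf.enorm).symm
      _ ≤ ∫⁻ x in A, ((∫⁻ w in B, ‖f (x + w) - f x‖ₑ) + volume B) := setLIntegral_mono' hA hpt
      _ = (∫⁻ x in A, ∫⁻ w in B, ‖f (x + w) - f x‖ₑ) + volume B * volume A := by
          rw [lintegral_add_right _ measurable_const]
          simp
      _ ≤ S * volume B + volume B * volume A := by
          gcongr
          exact lintegral_lintegral_translate_le hB hf hS
      _ = (S + volume A) * (2 * (volume B / 2)) := by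
          rw [ENNReal.mul_div_cancel two_ne_zero (by simp)]
          ring
      _ = 2 * (S + volume A) * (volume B / 2) := by ring
  exact (ENNReal.mul_le_mul_iff_left (ENNReal.div_pos hB0 (by simp)).ne'
    (ENNReal.div_ne_top hBt two_ne_zero)).1 h1

/-- Comparison of `f` on `A` with its integrals over balls of radius `ρ`, whose centres `σ x + p`
only depend on a coarse approximation `σ x` of `x`. -/
lemma volume_mul_lintegral_enorm_le {A : Set (EuclideanSpace ℝ (Fin n))}
    {p : EuclideanSpace ℝ (Fin n)} {ρ : ℝ}
    {f : EuclideanSpace ℝ (Fin n) → ℝ} (hf : Measurable f) (hfi : Integrable f) {S : ℝ≥0∞}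
    (hS : ∀ w ∈ Metric.closedBall p (2 * ρ), ∫⁻ x in A, ‖f (x + w) - f x‖ₑ ≤ S)
    {σ : EuclideanSpace ℝ (Fin n) → EuclideanSpace ℝ (Fin n)} (hσ : ∀ x, dist (σ x) x ≤ ρ) :
    volume (Metric.closedBall (0 : EuclideanSpace ℝ (Fin n)) ρ) * ∫⁻ x in A, ‖f x‖ₑ
      ≤ (∫⁻ x in A, ‖∫ y in Metric.closedBall (σ x + p) ρ, f y‖ₑ)
        + S * volume (Metric.closedBall p (2 * ρ)) := by
  have hpt : ∀ x, volume (Metric.closedBall (0 : EuclideanSpace ℝ (Fin n)) ρ) * ‖f x‖ₑ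
      ≤ ‖∫ y in Metric.closedBall (σ x + p) ρ, f y‖ₑ
        + ∫⁻ w in Metric.closedBall p (2 * ρ), ‖f (x + w) - f x‖ₑ := by
    intro x
    set B' := Metric.closedBall (σ x + p) ρ with hB'
    have hvol : volume (Metric.closedBall (0 : EuclideanSpace ℝ (Fin n)) ρ) = volume B' :=
      (Measure.addHaar_closedBall_center _ _ _).symm
    have hB't : volume B' < ⊤ := measure_closedBall_lt_top
    have hci : IntegrableOn (fun _ => f x) B' volume := integrableOn_const hB't.ne
    have e1 : volume B' * ‖f x‖ₑ = ‖∫ _ in B', f x‖ₑ := by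
      rw [setIntegral_const, enorm_smul, Measure.real, Real.enorm_of_nonneg ENNReal.toReal_nonneg,
        ENNReal.ofReal_toReal hB't.ne]
    have e2 : ∫ _ in B', f x = (∫ y in B', f y) - ∫ y in B', (f y - f x) := by
      rw [integral_sub hfi.integrableOn hci]
      ring
    have e3 : ∫⁻ y in B', ‖f y - f x‖ₑ
        ≤ ∫⁻ w in Metric.closedBall p (2 * ρ), ‖f (x + w) - f x‖ₑ := by
      rw [← (measurePreserving_add_left volume x).setLIntegral_comp_preimage
        Metric.isClosed_closedBall.measurableSet (f := fun y => ‖f y - f x‖ₑ) (by fun_prop)]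
      refine lintegral_mono_set fun w hw => ?_
      have h1 : dist (x + w) (σ x + p) ≤ ρ := hw
      have h2 := hσ x
      rw [Metric.mem_closedBall]
      rw [dist_eq_norm] at h1 h2 ⊢
      have : w - p = (x + w - (σ x + p)) + (σ x - x) := by abel
      rw [this]
      exact (norm_add_le _ _).trans (by linarith)
    rw [hvol, e1, e2]
    refine enorm_sub_le.trans (add_le_add_right ((enorm_integral_le_lintegral_enorm _).trans e3) _)
  rw [← lintegral_const_mul _ hf.enorm]
  refine (lintegral_mono hpt).trans ?_
  rw [lintegral_add_right _ (measurable_enorm_translate_sub hf).lintegral_prod_right']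
  gcongr
  exact lintegral_lintegral_translate_le Metric.isClosed_closedBall.measurableSet hf hS

/-! ### Compactness on one piece of the domain -/

/-- `f` is a Cauchy sequence in `L¹(S)`. -/
def IsL1CauchyOn (S : Set (EuclideanSpace ℝ (Fin n))) (f : ℕ → EuclideanSpace ℝ (Fin n) → ℝ) :
    Prop :=
  ∀ η : ℝ≥0∞, η ≠ 0 → ∃ N, ∀ i ≥ N, ∀ j ≥ N, ∫⁻ x in S, ‖f i x - f j x‖ₑ ≤ η

lemma IsL1CauchyOn.comp_strictMono {S : Set (EuclideanSpace ℝ (Fin n))}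
    {f : ℕ → EuclideanSpace ℝ (Fin n) → ℝ} (h : IsL1CauchyOn S f) {k : ℕ → ℕ}
    (hk : StrictMono k) : IsL1CauchyOn S (fun m => f (k m)) := by
  intro η hη
  obtain ⟨N, hN⟩ := h η hη
  exact ⟨N, fun i hi j hj => hN _ (hi.trans (hk.id_le i)) _ (hj.trans (hk.id_le j))⟩

lemma IsL1CauchyOn.mono {S S' : Set (EuclideanSpace ℝ (Fin n))}
    {f : ℕ → EuclideanSpace ℝ (Fin n) → ℝ} (h : IsL1CauchyOn S f) (hS : S' ⊆ S) :
    IsL1CauchyOn S' f := by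
  intro η hη
  obtain ⟨N, hN⟩ := h η hη
  exact ⟨N, fun i hi j hj => (lintegral_mono_set hS).trans (hN i hi j hj)⟩

lemma IsL1CauchyOn.union {S S' : Set (EuclideanSpace ℝ (Fin n))}
    {f : ℕ → EuclideanSpace ℝ (Fin n) → ℝ} (h : IsL1CauchyOn S f) (h' : IsL1CauchyOn S' f) :
    IsL1CauchyOn (S ∪ S') f := by
  intro η hη
  obtain ⟨N, hN⟩ := h (η / 2) (ENNReal.half_pos hη).ne'
  obtain ⟨N', hN'⟩ := h' (η / 2) (ENNReal.half_pos hη).ne'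
  refine ⟨max N N', fun i hi j hj => ?_⟩
  calc _ ≤ (∫⁻ x in S, ‖f i x - f j x‖ₑ) + ∫⁻ x in S', ‖f i x - f j x‖ₑ :=
        lintegral_union_le _ _ _
    _ ≤ η / 2 + η / 2 := add_le_add
        (hN i (le_of_max_le_left hi) j (le_of_max_le_left hj))
        (hN' i (le_of_max_le_right hi) j (le_of_max_le_right hj))
    _ = η := ENNReal.add_halves η

/-- Points of a dense sequence, chosen measurably, approximate every point up to `ρ`. -/
lemma exists_measurable_index_dist_le {ρ : ℝ} (hρ : 0 < ρ) :
    ∃ N : EuclideanSpace ℝ (Fin n) → ℕ, Measurable N ∧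
      ∀ x, dist (TopologicalSpace.denseSeq (EuclideanSpace ℝ (Fin n)) (N x)) x ≤ ρ := by
  classical
  have hex : ∀ x : EuclideanSpace ℝ (Fin n),
      ∃ i, dist (TopologicalSpace.denseSeq (EuclideanSpace ℝ (Fin n)) i) x ≤ ρ := by
    intro x
    obtain ⟨i, hi⟩ :=
      (TopologicalSpace.denseRange_denseSeq (EuclideanSpace ℝ (Fin n))).exists_dist_lt x hρ
    exact ⟨i, by rw [dist_comm]; exact hi.le⟩
  refine ⟨fun x => Nat.find (hex x), measurable_find hex fun i => ?_,
    fun x => Nat.find_spec (hex x)⟩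
  exact measurableSet_le (by fun_prop) measurable_const

/-- A bounded doubly indexed family of real sequences has a subsequence along which they all
converge. -/
lemma exists_subseq_forall_tendsto {a : ℕ → ℕ × ℕ → ℝ} {L : ℝ} (ha : ∀ j i, |a j i| ≤ L) :
    ∃ (k : ℕ → ℕ) (b : ℕ × ℕ → ℝ), StrictMono k ∧
      ∀ i, Tendsto (fun m => a (k m) i) atTop (𝓝 (b i)) := by
  have hc : IsCompact (univ.pi fun _ : ℕ × ℕ => Icc (-L) L) :=
    isCompact_univ_pi fun _ => isCompact_Icc
  obtain ⟨b, -, k, hk, hb⟩ := hc.tendsto_subseq (x := a) fun j i _ => abs_le.1 (ha j i)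
  exact ⟨k, b, hk, fun i => (tendsto_pi_nhds.1 hb) i⟩

/-- Compactness on one piece of the domain: a bounded sequence of functions whose increments
in the directions of a cone are uniformly small has a Cauchy subsequence. -/
lemma exists_subseq_isL1CauchyOn {A : Set (EuclideanSpace ℝ (Fin n))} (hA : volume A ≠ ⊤)
    {u : ℕ → EuclideanSpace ℝ (Fin n) → ℝ} (hum : ∀ j, Measurable (u j))
    (hui : ∀ j, Integrable (u j)) {L : ℝ} (hL : ∀ j, ∫ x, ‖u j x‖ ≤ L)
    {v : EuclideanSpace ℝ (Fin n)} {c T D : ℝ} (hc : 0 < c) (hT : 0 < T)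
    (hdiff : ∀ j, ∀ t ∈ Ioc 0 T, ∀ w ∈ Metric.closedBall (t • v) (c * t),
      ∫⁻ x in A, ‖u j (x + w) - u j x‖ₑ ≤ ENNReal.ofReal (t * D)) :
    ∃ k : ℕ → ℕ, StrictMono k ∧ IsL1CauchyOn A (fun m => u (k m)) := by
  let d := TopologicalSpace.denseSeq (EuclideanSpace ℝ (Fin n))
  let t : ℕ → ℝ := fun q => T / (q + 1)
  have ht : ∀ q, t q ∈ Ioc 0 T := fun q =>
    ⟨by positivity, div_le_self hT.le (by linarith [(Nat.cast_nonneg q : (0 : ℝ) ≤ q)])⟩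
  let B : ℕ → EuclideanSpace ℝ (Fin n) → Set (EuclideanSpace ℝ (Fin n)) := fun q z =>
    Metric.closedBall (z + t q • v) (c * t q / 2)
  let a : ℕ → ℕ × ℕ → ℝ := fun j i => ∫ y in B i.1 (d i.2), u j y
  have ha : ∀ j i, |a j i| ≤ L := by
    intro j i
    calc |a j i| ≤ ∫ y in B i.1 (d i.2), ‖u j y‖ := norm_integral_le_integral_norm (u j)
      _ ≤ ∫ y, ‖u j y‖ := setIntegral_le_integral (hui j).norm (ae_of_all _ fun _ => norm_nonneg _)
      _ ≤ L := hL j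
  obtain ⟨k, b, hk, hb⟩ := exists_subseq_forall_tendsto ha
  refine ⟨k, hk, ?_⟩
  intro η hη
  -- a scale `t q` at which the increments contribute at most `η / 2`
  obtain ⟨q, hq⟩ : ∃ q, 2 ^ n * (2 * ENNReal.ofReal (t q * D)) ≤ η / 2 := by
    have h1 : Tendsto (fun q => t q * D) atTop (𝓝 (0 * D)) := by
      refine Tendsto.mul_const D (tendsto_const_nhds.div_atTop ?_)
      exact tendsto_atTop_add_const_right _ _ tendsto_natCast_atTop_atTop
    have h2 : Tendsto (fun q => 2 ^ n * (2 * ENNReal.ofReal (t q * D))) atTop (𝓝 0) := by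
      have h3 := ENNReal.Tendsto.const_mul (a := 2 ^ n) (ENNReal.Tendsto.const_mul (a := 2)
        (ENNReal.tendsto_ofReal h1) (Or.inr (by simp))) (Or.inr (by simp))
      simpa using h3
    exact (h2.eventually_le_const (ENNReal.half_pos hη)).exists
  set ρ := c * t q / 2 with hρ
  have hρ0 : 0 < ρ := by have := (ht q).1; positivity
  obtain ⟨N, hNm, hN⟩ := exists_measurable_index_dist_le (n := n) hρ0
  have hvol0 : volume (Metric.closedBall (0 : EuclideanSpace ℝ (Fin n)) ρ) ≠ 0 :=
    (Metric.measure_closedBall_pos _ _ hρ0).ne'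
  have hvolt : volume (Metric.closedBall (0 : EuclideanSpace ℝ (Fin n)) ρ) ≠ ⊤ :=
    measure_closedBall_lt_top.ne
  have hvol2 : volume (Metric.closedBall (t q • v) (2 * ρ))
      = 2 ^ n * volume (Metric.closedBall (0 : EuclideanSpace ℝ (Fin n)) ρ) := by
    rw [Measure.addHaar_closedBall_mul _ _ two_pos.le hρ0.le,
      finrank_euclideanSpace_fin, ENNReal.ofReal_pow two_pos.le]
    simp
  -- averages converge in `L¹(A)`
  have hlim : Tendsto (fun m => ∫⁻ x in A, ‖a (k m) (q, N x) - b (q, N x)‖ₑ) atTop (𝓝 0) := by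
    have hmeas : ∀ e : ℕ → ℝ, Measurable fun x : EuclideanSpace ℝ (Fin n) => e (N x) :=
      fun e => (measurable_of_countable e).comp hNm
    have h1 := tendsto_lintegral_of_dominated_convergence (μ := volume.restrict A)
      (F := fun m x => ‖a (k m) (q, N x) - b (q, N x)‖ₑ) (f := fun _ => 0)
      (fun _ => ENNReal.ofReal (2 * L))
      (fun m => (hmeas fun i => a (k m) (q, i) - b (q, i)).enorm)
      (fun m => ae_of_all _ fun x => ?_) ?_ (ae_of_all _ fun x => ?_)
    · simpa using h1
    · have hbL : |b (q, N x)| ≤ L :=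
        le_of_tendsto (hb (q, N x)).abs (Eventually.of_forall fun m => ha _ _)
      simp only [Real.enorm_eq_ofReal_abs]
      apply ENNReal.ofReal_le_ofReal
      have := abs_sub (a (k m) (q, N x)) (b (q, N x))
      linarith [ha (k m) (q, N x)]
    · simp [ENNReal.mul_eq_top, hA]
    · have h2 := ((hb (q, N x)).sub_const (b (q, N x))).enorm
      simpa using h2
  obtain ⟨M, hM⟩ := eventually_atTop.1 (hlim.eventually_le_const
    (ENNReal.half_pos (ENNReal.mul_pos (ENNReal.half_pos hη).ne' hvol0).ne'))
  refine ⟨M, fun i hi j hj => ?_⟩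
  have hS : ∀ w ∈ Metric.closedBall (t q • v) (2 * ρ),
      ∫⁻ x in A, ‖(u (k i) (x + w) - u (k j) (x + w)) - (u (k i) x - u (k j) x)‖ₑ
        ≤ 2 * ENNReal.ofReal (t q * D) := by
    intro w hw
    have h2ρ : 2 * ρ = c * t q := by rw [hρ]; ring
    rw [h2ρ] at hw
    have hm := hum (k j)
    calc _ ≤ ∫⁻ x in A, (‖u (k i) (x + w) - u (k i) x‖ₑ + ‖u (k j) (x + w) - u (k j) x‖ₑ) := by
          refine lintegral_mono fun x => ?_
          rw [sub_sub_sub_comm]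
          exact enorm_sub_le
      _ = _ := lintegral_add_right _ (by fun_prop)
      _ ≤ _ := by
          rw [two_mul]
          exact add_le_add (hdiff _ _ (ht q) w hw) (hdiff _ _ (ht q) w hw)
  have hmain := volume_mul_lintegral_enorm_le (A := A) (p := t q • v) (ρ := ρ)
    (f := fun x => u (k i) x - u (k j) x) ((hum _).sub (hum _)) ((hui _).sub (hui _)) hS hN
  have havg : ∫⁻ x in A, ‖∫ y in Metric.closedBall (d (N x) + t q • v) ρ,
      (u (k i) y - u (k j) y)‖ₑ
        ≤ η / 2 * volume (Metric.closedBall (0 : EuclideanSpace ℝ (Fin n)) ρ) := by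
    have hmeas : Measurable fun x : EuclideanSpace ℝ (Fin n) =>
        ‖a (k j) (q, N x) - b (q, N x)‖ₑ :=
      ((measurable_of_countable fun l => a (k j) (q, l) - b (q, l)).comp hNm).enorm
    calc _ ≤ ∫⁻ x in A, (‖a (k i) (q, N x) - b (q, N x)‖ₑ
            + ‖a (k j) (q, N x) - b (q, N x)‖ₑ) := by
          refine lintegral_mono fun x => ?_
          rw [integral_sub (hui _).integrableOn (hui _).integrableOn]
          change ‖a (k i) (q, N x) - a (k j) (q, N x)‖ₑ ≤ _
          rw [← sub_sub_sub_cancel_right _ _ (b (q, N x))]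
          exact enorm_sub_le
      _ = _ := lintegral_add_right _ hmeas
      _ ≤ _ := add_le_add (hM i hi) (hM j hj)
      _ = _ := ENNReal.add_halves _
  rw [hvol2] at hmain
  refine (ENNReal.mul_le_mul_iff_right hvol0 hvolt).1 (hmain.trans ?_)
  calc _ ≤ η / 2 * volume (Metric.closedBall (0 : EuclideanSpace ℝ (Fin n)) ρ)
        + 2 * ENNReal.ofReal (t q * D)
          * (2 ^ n * volume (Metric.closedBall (0 : EuclideanSpace ℝ (Fin n)) ρ)) := by
        gcongr
    _ = volume (Metric.closedBall (0 : EuclideanSpace ℝ (Fin n)) ρ)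
        * (η / 2 + 2 ^ n * (2 * ENNReal.ofReal (t q * D))) := by ring
    _ ≤ volume (Metric.closedBall (0 : EuclideanSpace ℝ (Fin n)) ρ) * (η / 2 + η / 2) := by
        gcongr
    _ = _ := by rw [ENNReal.add_halves]

/-! ### Compactness and `L¹` bounds on Lipschitz domains -/

/-- Rellich compactness in `L¹` on bounded Lipschitz domains. -/
lemma exists_subseq_isL1CauchyOn_of_isWeakGradient {Ω : Set (EuclideanSpace ℝ (Fin n))}
    (hΩ : IsOpen Ω) (hΩb : Bornology.IsBounded Ω) (hΩL : HasLipschitzBoundary Ω)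
    {u : ℕ → EuclideanSpace ℝ (Fin n) → ℝ} (hum : ∀ j, Measurable (u j))
    (hui : ∀ j, Integrable (u j)) {L : ℝ} (hL : ∀ j, ∫ x, ‖u j x‖ ≤ L)
    {G : ℕ → EuclideanSpace ℝ (Fin n) → EuclideanSpace ℝ (Fin n)}
    (hG : ∀ j, IntegrableOn (G j) Ω) (hw : ∀ j, IsWeakGradient Ω (u j) (G j))
    {C : ℝ} (hC : ∀ j, ∫ x in Ω, ‖G j x‖ ≤ C) :
    ∃ k : ℕ → ℕ, StrictMono k ∧ IsL1CauchyOn Ω (fun m => u (k m)) := by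
  have hind : ∀ k₀ : ℕ → ℕ, StrictMono k₀ → ∃ k : ℕ → ℕ, StrictMono k ∧
      IsL1CauchyOn (Ω ∩ closure Ω) (fun m => u (k₀ (k m))) := by
    refine IsCompact.induction_on (p := fun S => ∀ k₀ : ℕ → ℕ, StrictMono k₀ → ∃ k : ℕ → ℕ,
      StrictMono k ∧ IsL1CauchyOn (Ω ∩ S) (fun m => u (k₀ (k m)))) hΩb.isCompact_closure
      ?_ ?_ ?_ ?_
    · exact fun k₀ _ => ⟨id, strictMono_id, fun η _ => ⟨0, by simp⟩⟩
    · intro S S' hS h k₀ hk₀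
      obtain ⟨k, hk, hc⟩ := h k₀ hk₀
      exact ⟨k, hk, hc.mono (inter_subset_inter_right _ hS)⟩
    · intro S S' h h' k₀ hk₀
      obtain ⟨k, hk, hc⟩ := h k₀ hk₀
      obtain ⟨k', hk', hc'⟩ := h' (fun m => k₀ (k m)) (hk₀.comp hk)
      refine ⟨fun m => k (k' m), hk.comp hk', ?_⟩
      rw [inter_union_distrib_left]
      exact (hc.comp_strictMono hk').union hc'
    · intro x₀ hx₀
      obtain ⟨r, hr, v, c, hc, T, hT, hcone⟩ := hΩL.hasUniformCone hΩ hx₀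
      refine ⟨Metric.ball x₀ r, mem_nhdsWithin_of_mem_nhds (Metric.ball_mem_nhds _ hr), ?_⟩
      intro k₀ _
      refine exists_subseq_isL1CauchyOn (v := v) (c := c) (T := T) (D := (‖v‖ + c) * C)
        (measure_ne_top_of_subset inter_subset_right measure_ball_lt_top.ne)
        (fun j => hum (k₀ j)) (fun j => hui _) (fun j => hL _) hc hT ?_
      intro j t ht w hw'
      refine ((hw (k₀ j)).lintegral_enorm_translate_sub_le_of_cone hΩ hcone (hui _) (hG _) ht
        hw').trans (ENNReal.ofReal_le_ofReal ?_)
      have := ht.1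
      gcongr
      exact hC _
  obtain ⟨k, hk, hc⟩ := hind id strictMono_id
  rw [inter_eq_self_of_subset_left subset_closure] at hc
  exact ⟨k, hk, hc⟩

/-- The negative parts are bounded in `L¹(Ω)` as soon as they exceed `1` only on sets of
vanishing measure. No connectedness of `Ω` is needed: large negative values are excluded near each
point of `closure Ω` separately. -/
lemma exists_bound_lintegral_negPart {Ω : Set (EuclideanSpace ℝ (Fin n))}
    (hΩ : IsOpen Ω) (hΩb : Bornology.IsBounded Ω) (hΩL : HasLipschitzBoundary Ω)
    {u : ℕ → EuclideanSpace ℝ (Fin n) → ℝ} (hum : ∀ j, Measurable (u j))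
    (hui : ∀ j, Integrable (u j))
    {G : ℕ → EuclideanSpace ℝ (Fin n) → EuclideanSpace ℝ (Fin n)}
    (hG : ∀ j, IntegrableOn (G j) Ω) (hw : ∀ j, IsWeakGradient Ω (u j) (G j))
    {C : ℝ} (hC : ∀ j, ∫ x in Ω, ‖G j x‖ ≤ C)
    (hlevel : Tendsto (fun j => volume {x ∈ Ω | u j x < -1}) atTop (𝓝 0)) :
    ∃ L : ℝ≥0∞, L ≠ ⊤ ∧ ∀ᶠ j in atTop, ∫⁻ x in Ω, ‖min (u j x) 0‖ₑ ≤ L := by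
  have hind : ∃ L : ℝ≥0∞, L ≠ ⊤ ∧
      ∀ᶠ j in atTop, ∫⁻ x in Ω ∩ closure Ω, ‖min (u j x) 0‖ₑ ≤ L := by
    refine IsCompact.induction_on (p := fun S => ∃ L : ℝ≥0∞, L ≠ ⊤ ∧
      ∀ᶠ j in atTop, ∫⁻ x in Ω ∩ S, ‖min (u j x) 0‖ₑ ≤ L) hΩb.isCompact_closure ?_ ?_ ?_ ?_
    · exact ⟨0, by simp⟩
    · rintro S S' hS ⟨L, hL, h⟩
      exact ⟨L, hL, h.mono fun j hj =>
        (lintegral_mono_set (inter_subset_inter_right _ hS)).trans hj⟩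
    · rintro S S' ⟨L, hL, h⟩ ⟨L', hL', h'⟩
      refine ⟨L + L', ENNReal.add_ne_top.2 ⟨hL, hL'⟩, ?_⟩
      filter_upwards [h, h'] with j hj hj'
      rw [inter_union_distrib_left]
      exact (lintegral_union_le _ _ _).trans (add_le_add hj hj')
    · intro x₀ hx₀
      obtain ⟨r, hr, v, c, hc, T, hT, hcone⟩ := hΩL.hasUniformCone hΩ hx₀
      refine ⟨Metric.ball x₀ r, mem_nhdsWithin_of_mem_nhds (Metric.ball_mem_nhds _ hr), ?_⟩
      have hA : volume (Ω ∩ Metric.ball x₀ r) ≠ ⊤ :=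
        measure_ne_top_of_subset inter_subset_right measure_ball_lt_top.ne
      set B := Metric.closedBall (T • v) (c * T) with hB
      have hB0 : volume B ≠ 0 := (Metric.measure_closedBall_pos _ _ (by positivity)).ne'
      have hTT : T ∈ Ioc 0 T := ⟨hT, le_rfl⟩
      refine ⟨2 * (ENNReal.ofReal (T * ((‖v‖ + c) * C)) + volume (Ω ∩ Metric.ball x₀ r)),
        by simp [ENNReal.mul_eq_top, hA], ?_⟩
      filter_upwards [hlevel.eventually_le_const (ENNReal.half_pos hB0)] with j hj
      refine lintegral_enorm_le_of_measure_superlevel_le (B := B) (Ω := Ω)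
        (hΩ.inter Metric.isOpen_ball).measurableSet Metric.isClosed_closedBall.measurableSet hB0
        measure_closedBall_lt_top.ne (fun x hx w hw' => hcone x hx T hTT w hw')
        ((hum j).min measurable_const) ?_ ?_
      · intro w hw'
        refine le_trans (lintegral_mono fun x => ?_)
          (((hw j).lintegral_enorm_translate_sub_le_of_cone hΩ hcone (hui _) (hG _) hTT
            hw').trans (ENNReal.ofReal_le_ofReal ?_))
        · rw [Real.enorm_eq_ofReal_abs, Real.enorm_eq_ofReal_abs]
          apply ENNReal.ofReal_le_ofReal
          have := abs_min_sub_min_le_max (u j (x + w)) 0 (u j x) 0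
          simpa using this
        · gcongr
          exact hC _
      · have hsub : {x ∈ Ω | 1 < ‖min (u j x) 0‖ₑ} ⊆ {x ∈ Ω | u j x < -1} := ?_
        · exact (measure_mono hsub).trans hj
        intro x hx
        refine ⟨hx.1, ?_⟩
        have h1 := hx.2
        rw [Real.enorm_eq_ofReal_abs, ENNReal.one_lt_ofReal] at h1
        by_contra h2
        rw [not_lt] at h2
        have h3 : |min (u j x) 0| ≤ 1 := abs_le.2
          ⟨le_min h2 (by norm_num), (min_le_right _ _).trans zero_le_one⟩
        linarith
  rwa [inter_eq_self_of_subset_left subset_closure] at hind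

/-- Completeness of `L¹`. -/
lemma IsL1CauchyOn.exists_tendsto {S : Set (EuclideanSpace ℝ (Fin n))}
    {f : ℕ → EuclideanSpace ℝ (Fin n) → ℝ} (h : IsL1CauchyOn S f)
    (hf : ∀ j, IntegrableOn (f j) S) :
    ∃ g : EuclideanSpace ℝ (Fin n) → ℝ, IntegrableOn g S ∧
      Tendsto (fun j => eLpNorm (f j - g) 1 (volume.restrict S)) atTop (𝓝 0) := by
  have hLp : ∀ j, MemLp (f j) 1 (volume.restrict S) := fun j => memLp_one_iff_integrable.2 (hf j)
  have hcauchy : CauchySeq fun j => (hLp j).toLp (f j) := by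
    rw [EMetric.cauchySeq_iff]
    intro η hη
    obtain ⟨η', hη', hlt⟩ := exists_between hη
    obtain ⟨N, hN⟩ := h η' hη'.ne'
    refine ⟨N, fun i hi j hj => ?_⟩
    rw [Lp.edist_toLp_toLp, eLpNorm_one_eq_lintegral_enorm]
    exact (hN i hi j hj).trans_lt hlt
  obtain ⟨g, hg⟩ := cauchySeq_tendsto_of_complete hcauchy
  refine ⟨g, memLp_one_iff_integrable.1 (Lp.memLp g), ?_⟩
  rw [Lp.tendsto_Lp_iff_tendsto_eLpNorm'] at hg
  refine hg.congr fun j => eLpNorm_congr_ae ?_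
  exact (hLp j).coeFn_toLp.sub EventuallyEq.rfl

/-! ### Limits of bounded variation -/

/-- Weak-* compactness of nonnegative densities bounded in `L¹`: along a nonprincipal ultrafilter
they converge to a locally finite measure. -/
lemma exists_measure_tendsto_hyperfilter {Ω : Set (EuclideanSpace ℝ (Fin n))}
    {Φ : ℕ → EuclideanSpace ℝ (Fin n) → ℝ} (hΦ0 : ∀ j x, 0 ≤ Φ j x)
    (hΦ : ∀ j, IntegrableOn (Φ j) Ω) {C : ℝ} (hC : ∀ j, ∫ x in Ω, Φ j x ≤ C) :
    ∃ μ : Measure (EuclideanSpace ℝ (Fin n)), IsFiniteMeasureOnCompacts μ ∧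
      ∀ f : EuclideanSpace ℝ (Fin n) → ℝ, Continuous f → HasCompactSupport f →
        Tendsto (fun j => ∫ x in Ω, Φ j x * f x) (hyperfilter ℕ : Filter ℕ)
          (𝓝 (∫ x, f x ∂μ)) := by
  have hint : ∀ j (f : CompactlySupportedContinuousMap (EuclideanSpace ℝ (Fin n)) ℝ),
      IntegrableOn (fun x => Φ j x * f x) Ω := by
    intro j f
    obtain ⟨K, hK⟩ := f.hasCompactSupport.exists_bound_of_continuous f.continuous
    exact Integrable.mul_bdd (hΦ j) f.continuous.aestronglyMeasurable (ae_of_all _ hK)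
  have hex : ∀ f : CompactlySupportedContinuousMap (EuclideanSpace ℝ (Fin n)) ℝ, ∃ l : ℝ,
      Tendsto (fun j => ∫ x in Ω, Φ j x * f x) (hyperfilter ℕ : Filter ℕ) (𝓝 l) := by
    intro f
    obtain ⟨K, hK⟩ := f.hasCompactSupport.exists_bound_of_continuous f.continuous
    have hK0 : 0 ≤ K := (norm_nonneg _).trans (hK 0)
    have hb : ∀ j, (∫ x in Ω, Φ j x * f x) ∈ Metric.closedBall (0 : ℝ) (C * K) := by
      intro j
      rw [mem_closedBall_zero_iff]
      calc ‖∫ x in Ω, Φ j x * f x‖ ≤ ∫ x in Ω, Φ j x * K := by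
            refine norm_integral_le_of_norm_le ((hΦ j).mul_const K) (ae_of_all _ fun x => ?_)
            rw [norm_mul, Real.norm_of_nonneg (hΦ0 j x)]
            exact mul_le_mul_of_nonneg_left (hK x) (hΦ0 j x)
        _ = (∫ x in Ω, Φ j x) * K := integral_mul_const _ _
        _ ≤ C * K := mul_le_mul_of_nonneg_right (hC j) hK0
    obtain ⟨l, -, hl⟩ := (isCompact_closedBall (0 : ℝ) (C * K)).ultrafilter_le_nhds'
      ((hyperfilter ℕ).map fun j => ∫ x in Ω, Φ j x * f x)
      (Ultrafilter.mem_map.2 (Eventually.of_forall hb))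
    exact ⟨l, hl⟩
  choose Λ hΛ using hex
  let Λ' : CompactlySupportedContinuousMap (EuclideanSpace ℝ (Fin n)) ℝ →ₗ[ℝ] ℝ :=
    { toFun := Λ
      map_add' := fun f f' => by
        refine tendsto_nhds_unique (hΛ (f + f')) (((hΛ f).add (hΛ f')).congr fun j => ?_)
        rw [← integral_add (hint j f) (hint j f')]
        simp [mul_add]
      map_smul' := fun a f => by
        refine tendsto_nhds_unique (hΛ (a • f)) (((hΛ f).const_mul a).congr fun j => ?_)
        rw [← integral_const_mul]
        simp [mul_left_comm] }
  let Λp : CompactlySupportedContinuousMap (EuclideanSpace ℝ (Fin n)) ℝ →ₚ[ℝ] ℝ :=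
    PositiveLinearMap.mk₀ Λ' fun f hf => ge_of_tendsto (hΛ f) (Eventually.of_forall fun j =>
      integral_nonneg fun x => mul_nonneg (hΦ0 j x) (hf x))
  refine ⟨RealRMK.rieszMeasure Λp, inferInstance, fun f hf hfc => ?_⟩
  have := RealRMK.integral_rieszMeasure Λp ⟨⟨f, hf⟩, hfc⟩
  change ∫ x, f x ∂(RealRMK.rieszMeasure Λp) = Λ ⟨⟨f, hf⟩, hfc⟩ at this
  rw [this]
  exact hΛ ⟨⟨f, hf⟩, hfc⟩

/-- The difference of two locally finite measures, restricted to the bounded set `Ω` so as to be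
finite, integrates test functions on `Ω` as expected. -/
lemma exists_signedMeasure_integral_eq {Ω : Set (EuclideanSpace ℝ (Fin n))} (hΩ : IsOpen Ω)
    (hΩb : Bornology.IsBounded Ω) (μ ν : Measure (EuclideanSpace ℝ (Fin n)))
    [IsFiniteMeasureOnCompacts μ] [IsFiniteMeasureOnCompacts ν] :
    ∃ D : SignedMeasure (EuclideanSpace ℝ (Fin n)), ∀ ψ, IsTestFunction Ω ψ →
      ∫ᵛ x in Ω, ψ x ∂<•D = (∫ x, ψ x ∂μ) - ∫ x, ψ x ∂ν := by
  have hfin : ∀ (κ : Measure (EuclideanSpace ℝ (Fin n))) [IsFiniteMeasureOnCompacts κ],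
      IsFiniteMeasure (κ.restrict Ω) := fun κ _ =>
    ⟨by
      rw [Measure.restrict_apply_univ]
      exact (measure_mono subset_closure).trans_lt hΩb.isCompact_closure.measure_lt_top⟩
  have := hfin μ
  have := hfin ν
  refine ⟨(μ.restrict Ω).toSignedMeasure - (ν.restrict Ω).toSignedMeasure, fun ψ hψ => ?_⟩
  obtain ⟨K, hK⟩ := hψ.bounded
  have hi : ∀ (κ : Measure (EuclideanSpace ℝ (Fin n))) [IsFiniteMeasure κ],
      κ.toSignedMeasure.Integrable ψ := by
    intro κ _
    rw [VectorMeasure.Integrable, Measure.variation_toSignedMeasure]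
    exact Integrable.of_bound hψ.1.continuous.aestronglyMeasurable K (ae_of_all _ hK)
  have e : ∀ (κ : Measure (EuclideanSpace ℝ (Fin n))),
      ∫ x in Ω, ψ x ∂(κ.restrict Ω) = ∫ x, ψ x ∂κ := by
    intro κ
    rw [Measure.restrict_restrict hΩ.measurableSet, inter_self]
    exact setIntegral_eq_integral_of_forall_compl_eq_zero fun x hx =>
      image_eq_zero_of_notMem_tsupport fun h' => hx (hψ.2.2 h')
  rw [VectorMeasure.restrict_sub, VectorMeasure.integral_sub_vectorMeasure (hi _).restrict
    (hi _).restrict, VectorMeasure.setIntegral_toSignedMeasure hΩ.measurableSet,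
    VectorMeasure.setIntegral_toSignedMeasure hΩ.measurableSet, e, e]

/-- `L¹` limits of functions with weak gradients bounded in `L¹` have bounded variation. -/
lemma memBV_of_tendsto {Ω : Set (EuclideanSpace ℝ (Fin n))} (hΩ : IsOpen Ω)
    (hΩb : Bornology.IsBounded Ω) {f : ℕ → EuclideanSpace ℝ (Fin n) → ℝ}
    (hf : ∀ j, IntegrableOn (f j) Ω)
    {G : ℕ → EuclideanSpace ℝ (Fin n) → EuclideanSpace ℝ (Fin n)}
    (hG : ∀ j, IntegrableOn (G j) Ω) (hw : ∀ j, IsWeakGradient Ω (f j) (G j))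
    {C : ℝ} (hC : ∀ j, ∫ x in Ω, ‖G j x‖ ≤ C)
    {u : EuclideanSpace ℝ (Fin n) → ℝ} (hu : IntegrableOn u Ω)
    (hlim : Tendsto (fun j => eLpNorm (f j - u) 1 (volume.restrict Ω)) atTop (𝓝 0)) :
    MemBV Ω u := by
  have hGi : ∀ j i, IntegrableOn (fun x => G j x i) Ω := fun j i =>
    (EuclideanSpace.proj i : EuclideanSpace ℝ (Fin n) →L[ℝ] ℝ).integrable_comp (hG j)
  have hpart : ∀ i, ∃ D : SignedMeasure (EuclideanSpace ℝ (Fin n)), ∀ ψ, IsTestFunction Ω ψ →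
      Tendsto (fun j => ∫ x in Ω, ψ x * G j x i) (hyperfilter ℕ : Filter ℕ)
        (𝓝 (∫ᵛ x in Ω, ψ x ∂<•D)) := by
    intro i
    have hpos : ∀ s : ℝ, |s| ≤ 1 → ∀ j, ∫ x in Ω, max (s * G j x i) 0 ≤ C := by
      intro s hs j
      refine le_trans (integral_mono ((hGi j i).const_mul s).pos_part (hG j).norm fun x => ?_)
        (hC j)
      refine max_le ?_ (norm_nonneg _)
      calc s * G j x i ≤ |s| * |G j x i| := by rw [← abs_mul]; exact le_abs_self _
        _ ≤ 1 * ‖G j x‖ := by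
            gcongr
            exact PiLp.norm_apply_le (G j x) i
        _ = _ := one_mul _
    obtain ⟨μ, hμ, hμt⟩ := exists_measure_tendsto_hyperfilter
      (fun j x => le_max_right (1 * G j x i) 0) (fun j => ((hGi j i).const_mul 1).pos_part)
      (hpos 1 (by simp))
    obtain ⟨ν, hν, hνt⟩ := exists_measure_tendsto_hyperfilter
      (fun j x => le_max_right (-1 * G j x i) 0) (fun j => ((hGi j i).const_mul (-1)).pos_part)
      (hpos (-1) (by simp))
    obtain ⟨D, hD⟩ := exists_signedMeasure_integral_eq hΩ hΩb μ ν
    refine ⟨D, fun ψ hψ => ?_⟩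
    rw [hD ψ hψ]
    obtain ⟨K, hK⟩ := hψ.bounded
    refine ((hμt ψ hψ.1.continuous hψ.2.1).sub (hνt ψ hψ.1.continuous hψ.2.1)).congr fun j => ?_
    have hi : ∀ s : ℝ, Integrable (fun x => max (s * G j x i) 0 * ψ x) (volume.restrict Ω) :=
      fun s => Integrable.mul_bdd (((hGi j i).const_mul s).pos_part)
        hψ.1.continuous.aestronglyMeasurable (ae_of_all _ hK)
    rw [← integral_sub (hi 1) (hi (-1))]
    refine integral_congr_ae (ae_of_all _ fun x => ?_)
    rcases le_total 0 (G j x i) with h0 | h0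
    · simp [h0, mul_comm]
    · simp [h0, mul_comm]
  choose D hD using hpart
  refine ⟨hu, D, fun ψ hψ i => ?_⟩
  have hcd : Continuous (fderiv ℝ ψ) := hψ.1.continuous_fderiv (by simp)
  obtain ⟨K, hK⟩ := (hψ.2.1.fderiv ℝ).exists_bound_of_continuous hcd
  have hK' : ∀ x, ‖partialDeriv i ψ x‖ ≤ K := fun x =>
    ((fderiv ℝ ψ x).le_opNorm _).trans (by simpa using hK x)
  have hpd : Continuous (partialDeriv i ψ) := hcd.clm_apply continuous_const
  have hprod : ∀ {f : EuclideanSpace ℝ (Fin n) → ℝ}, IntegrableOn f Ω →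
      IntegrableOn (fun x => f x * partialDeriv i ψ x) Ω := fun hf =>
    Integrable.mul_bdd hf hpd.aestronglyMeasurable (ae_of_all _ hK')
  have h1 : Tendsto (fun j => ∫ x in Ω, f j x * partialDeriv i ψ x) atTop
      (𝓝 (∫ x in Ω, u x * partialDeriv i ψ x)) := by
    refine tendsto_integral_of_L1 _ (hprod hu).aestronglyMeasurable
      (Eventually.of_forall fun j => hprod (hf j)) ?_
    have h2 : Tendsto (fun j => ENNReal.ofReal K * eLpNorm (f j - u) 1 (volume.restrict Ω)) atTop
        (𝓝 0) := by
      simpa using ENNReal.Tendsto.const_mul hlim (Or.inr ENNReal.ofReal_ne_top)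
    refine tendsto_of_tendsto_of_tendsto_of_le_of_le tendsto_const_nhds h2 (fun _ => zero_le)
      fun j => ?_
    rw [eLpNorm_one_eq_lintegral_enorm, ← lintegral_const_mul' _ _ ENNReal.ofReal_ne_top]
    refine lintegral_mono fun x => ?_
    rw [← sub_mul, enorm_mul, mul_comm]
    gcongr
    · rw [← ofReal_norm]
      exact ENNReal.ofReal_le_ofReal (hK' x)
    · simp
  have h3 : Tendsto (fun j => ∫ x in Ω, f j x * partialDeriv i ψ x) (hyperfilter ℕ : Filter ℕ)
      (𝓝 (-∫ᵛ x in Ω, ψ x ∂<•(D i))) :=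
    (hD i ψ hψ).neg.congr fun j => (hw j ψ hψ i).symm
  exact tendsto_nhds_unique (h1.mono_left Nat.hyperfilter_le_atTop) h3

/-! ### Consequences of the energy bound -/

lemma IsInterpolation.neg_one_le {g : ℝ → ℝ} (hg : IsInterpolation g) (z : ℝ) : -1 ≤ g z := by
  have hc : Continuous g := hg.contDiff.continuous
  rw [← hg.map_zero]
  rcases lt_trichotomy z 0 with h | rfl | h
  · refine le_of_tendsto (x := 𝓝[<] 0) (hc.continuousAt.mono_left nhdsWithin_le_nhds) ?_
    filter_upwards [Ioo_mem_nhdsLT h] with y hy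
    exact (hg.strictAntiOn h hy.2 hy.1).le
  · exact le_rfl
  · refine le_of_tendsto (x := 𝓝[>] 0) (hc.continuousAt.mono_left nhdsWithin_le_nhds) ?_
    filter_upwards [Ioo_mem_nhdsGT h] with y hy
    exact (hg.strictMonoOn hy.1 h hy.2).le

lemma MemW11.weakGradient_spec {Ω : Set (EuclideanSpace ℝ (Fin n))}
    {u : EuclideanSpace ℝ (Fin n) → ℝ} (hu : MemW11 Ω u) :
    IntegrableOn (weakGradient Ω u) Ω ∧ IsWeakGradient Ω u (weakGradient Ω u) := by
  rw [weakGradient, dif_pos hu.2]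
  exact hu.2.choose_spec

lemma IsWeakGradient.congr_ae {Ω : Set (EuclideanSpace ℝ (Fin n))}
    {u u' : EuclideanSpace ℝ (Fin n) → ℝ}
    {G : EuclideanSpace ℝ (Fin n) → EuclideanSpace ℝ (Fin n)} (h : IsWeakGradient Ω u G)
    (huu' : u =ᵐ[volume.restrict Ω] u') : IsWeakGradient Ω u' G := by
  intro ψ hψ i
  rw [← h ψ hψ i]
  refine integral_congr_ae ?_
  filter_upwards [huu'] with x hx
  rw [hx]

/-- `W^{1,1}` functions have measurable, globally integrable representatives. -/
lemma MemW11.exists_representative {Ω : Set (EuclideanSpace ℝ (Fin n))} (hΩ : IsOpen Ω)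
    {h : EuclideanSpace ℝ (Fin n) → ℝ} (hh : MemW11 Ω h) :
    ∃ u : EuclideanSpace ℝ (Fin n) → ℝ, Measurable u ∧ Integrable u ∧ (∀ x ∉ Ω, u x = 0) ∧
      h =ᵐ[volume.restrict Ω] u ∧ IsWeakGradient Ω u (weakGradient Ω h) := by
  have hm := hh.1.aestronglyMeasurable
  have hae : h =ᵐ[volume.restrict Ω] Ω.indicator (hm.mk h) :=
    hm.ae_eq_mk.trans (indicator_ae_eq_restrict hΩ.measurableSet).symm
  refine ⟨Ω.indicator (hm.mk h), hm.stronglyMeasurable_mk.measurable.indicator hΩ.measurableSet,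
    ?_, fun x hx => indicator_of_notMem hx _, hae, hh.weakGradient_spec.2.congr_ae hae⟩
  rw [integrable_indicator_iff hΩ.measurableSet]
  exact hh.1.congr hm.ae_eq_mk

lemma ae_nonneg_of_tendsto {Ω : Set (EuclideanSpace ℝ (Fin n))} (hΩ : IsOpen Ω)
    {f : ℕ → EuclideanSpace ℝ (Fin n) → ℝ} {u : EuclideanSpace ℝ (Fin n) → ℝ}
    (hf : ∀ j, IntegrableOn (f j) Ω) (hu : IntegrableOn u Ω)
    (hlim : Tendsto (fun j => eLpNorm (f j - u) 1 (volume.restrict Ω)) atTop (𝓝 0))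
    (hlevel : ∀ δ > 0, Tendsto (fun j => volume {x ∈ Ω | f j x < -δ}) atTop (𝓝 0)) :
    ∀ᵐ x ∂(volume.restrict Ω), 0 ≤ u x := by
  have hmeas := tendstoInMeasure_of_tendsto_eLpNorm one_ne_zero
    (fun j => (hf j).aestronglyMeasurable) hu.aestronglyMeasurable hlim
  rw [tendstoInMeasure_iff_dist] at hmeas
  have key : ∀ δ > 0, ∀ᵐ x ∂(volume.restrict Ω), -(2 * δ) ≤ u x := by
    intro δ hδ
    rw [ae_iff]
    have hsum := (hlevel δ hδ).add (hmeas δ hδ)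
    rw [add_zero] at hsum
    refine le_antisymm (ge_of_tendsto hsum (Eventually.of_forall fun j => ?_)) zero_le
    have hle : (volume.restrict Ω) {x | f j x < -δ} = volume {x ∈ Ω | f j x < -δ} := by
      rw [Measure.restrict_apply' hΩ.measurableSet, inter_comm]
      rfl
    rw [← hle]
    refine (measure_mono fun x hx => ?_).trans (measure_union_le _ _)
    by_cases h1 : f j x < -δ
    · exact Or.inl h1
    · refine Or.inr ?_
      have hx' : ¬ -(2 * δ) ≤ u x := hx
      change δ ≤ dist (f j x) (u x)
      rw [Real.dist_eq]
      exact le_trans (by linarith) (le_abs_self _)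
  have hall : ∀ᵐ x ∂(volume.restrict Ω), ∀ m : ℕ, -(2 * (1 / ((m : ℝ) + 1))) ≤ u x :=
    ae_all_iff.2 fun m => key _ (by positivity)
  filter_upwards [hall] with x hx
  have h1 : Tendsto (fun m : ℕ => -(2 * (1 / ((m : ℝ) + 1)))) atTop (𝓝 (-(2 * 0))) :=
    (tendsto_one_div_add_atTop_nhds_zero_nat.const_mul 2).neg
  simpa using le_of_tendsto h1 (Eventually.of_forall hx)

lemma mul_lintegral_weakGradient_le {Ω : Set (EuclideanSpace ℝ (Fin n))}
    {γFV γVS γFS : ℝ} (hS : spreading γFV γVS γFS < 0) (ha : 0 < γVS - γFS)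
    {g : ℝ → ℝ} (hg : IsInterpolation g) (ε : ℝ)
    (h : EuclideanSpace ℝ (Fin n) → ℝ) (G : EuclideanSpace ℝ (Fin n) → EuclideanSpace ℝ (Fin n)) :
    ENNReal.ofReal (γVS - γFS) * ∫⁻ x in Ω, ‖G x‖ₑ
      ≤ ∫⁻ x in Ω, ENNReal.ofReal
        (density γFV γVS γFS g ε (h x) * Real.sqrt (1 + ‖G x‖ ^ 2)) := by
  rw [← lintegral_const_mul' _ _ ENNReal.ofReal_ne_top]
  refine lintegral_mono fun x => ?_
  rw [← ofReal_norm, ← ENNReal.ofReal_mul ha.le]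
  apply ENNReal.ofReal_le_ofReal
  have h1 : γVS - γFS ≤ density γFV γVS γFS g ε (h x) := by
    have := mul_nonneg (neg_nonneg.2 hS.le) (neg_le_iff_add_nonneg.1 (hg.neg_one_le (h x / ε)))
    unfold density
    unfold spreading at this ⊢
    linarith
  have h2 : ‖G x‖ ≤ Real.sqrt (1 + ‖G x‖ ^ 2) := Real.le_sqrt_of_sq_le (by linarith)
  exact mul_le_mul h1 h2 (norm_nonneg _) (ha.le.trans h1)

lemma ofReal_mul_measure_sublevel_le {Ω : Set (EuclideanSpace ℝ (Fin n))} (hΩ : IsOpen Ω)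
    {γFV γVS γFS : ℝ} (hFV : 0 < γFV) (hS : spreading γFV γVS γFS < 0)
    {g : ℝ → ℝ} (hg : IsInterpolation g) {ε δ : ℝ} (hε : 0 < ε) (hδ : 0 < δ)
    {h u : EuclideanSpace ℝ (Fin n) → ℝ} (hum : Measurable u)
    (hhu : h =ᵐ[volume.restrict Ω] u)
    (G : EuclideanSpace ℝ (Fin n) → EuclideanSpace ℝ (Fin n)) :
    ENNReal.ofReal (-spreading γFV γVS γFS * g (-δ / ε)) * volume {x ∈ Ω | u x < -δ}
      ≤ ∫⁻ x in Ω, ENNReal.ofReal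
        (density γFV γVS γFS g ε (h x) * Real.sqrt (1 + ‖G x‖ ^ 2)) := by
  have hA : MeasurableSet {x ∈ Ω | u x < -δ} :=
    hΩ.measurableSet.inter (measurableSet_lt hum measurable_const)
  have hsub : {x ∈ Ω | u x < -δ} ⊆ Ω := fun x hx => hx.1
  refine le_trans ?_ (lintegral_mono_set hsub)
  rw [← setLIntegral_const]
  refine lintegral_mono_ae ?_
  filter_upwards [ae_restrict_of_ae_restrict_of_subset hsub hhu, ae_restrict_mem hA] with x hx hxA
  rw [hx]
  rcases le_total (g (-δ / ε)) 0 with hneg | hpos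
  · rw [ENNReal.ofReal_of_nonpos (mul_nonpos_of_nonneg_of_nonpos (by linarith) hneg)]
    exact zero_le
  apply ENNReal.ofReal_le_ofReal
  have hlt : u x / ε < -δ / ε := div_lt_div_of_pos_right hxA.2 hε
  have hδε : -δ / ε < 0 := div_neg_of_neg_of_pos (by linarith) hε
  have h1 : g (-δ / ε) ≤ g (u x / ε) := (hg.strictAntiOn (hlt.trans hδε) hδε hlt).le
  have h2 : -spreading γFV γVS γFS * g (-δ / ε) ≤ density γFV γVS γFS g ε (u x) := by
    have := mul_le_mul_of_nonneg_left h1 (neg_nonneg.2 hS.le)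
    unfold density
    linarith
  have h3 : 1 ≤ Real.sqrt (1 + ‖G x‖ ^ 2) := Real.one_le_sqrt.2 (by linarith [sq_nonneg ‖G x‖])
  have h4 : 0 ≤ -spreading γFV γVS γFS * g (-δ / ε) :=
    mul_nonneg (by linarith) hpos
  exact h2.trans (le_mul_of_one_le_right (h4.trans h2) h3)

/-- Bounded energy forces `h ≥ -δ` up to sets of vanishing measure, since `g → +∞` at `-∞`. -/
lemma tendsto_measure_sublevel {Ω : Set (EuclideanSpace ℝ (Fin n))} (hΩ : IsOpen Ω)
    {γFV γVS γFS : ℝ} (hFV : 0 < γFV) (hS : spreading γFV γVS γFS < 0)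
    {g : ℝ → ℝ} (hg : IsInterpolation g) {ε : ℕ → ℝ} (hε : ∀ j, 0 < ε j)
    (hε0 : Tendsto ε atTop (𝓝 0)) {h u : ℕ → EuclideanSpace ℝ (Fin n) → ℝ}
    (hum : ∀ j, Measurable (u j)) (hhu : ∀ j, h j =ᵐ[volume.restrict Ω] u j)
    (G : ℕ → EuclideanSpace ℝ (Fin n) → EuclideanSpace ℝ (Fin n)) {M : ℝ≥0∞} (hM : M ≠ ⊤)
    (hE : ∀ j, ∫⁻ x in Ω, ENNReal.ofReal
      (density γFV γVS γFS g (ε j) (h j x) * Real.sqrt (1 + ‖G j x‖ ^ 2)) ≤ M)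
    {δ : ℝ} (hδ : 0 < δ) :
    Tendsto (fun j => volume {x ∈ Ω | u j x < -δ}) atTop (𝓝 0) := by
  have hinv : Tendsto (fun j => -δ / ε j) atTop atBot := by
    have h1 : Tendsto (fun j => (ε j)⁻¹) atTop atTop :=
      tendsto_inv_nhdsGT_zero.comp (tendsto_nhdsWithin_iff.2 ⟨hε0, Eventually.of_forall hε⟩)
    simpa [div_eq_mul_inv] using h1.const_mul_atTop_of_neg (neg_neg_of_pos hδ)
  have hd : Tendsto (fun j => ENNReal.ofReal (-spreading γFV γVS γFS * g (-δ / ε j))) atTop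
      (𝓝 ⊤) :=
    ENNReal.tendsto_ofReal_nhds_top.2
      ((hg.tendsto_atBot.comp hinv).const_mul_atTop (neg_pos.2 hS))
  have hq : Tendsto (fun j => M / ENNReal.ofReal (-spreading γFV γVS γFS * g (-δ / ε j))) atTop
      (𝓝 0) := by
    have := ENNReal.Tendsto.const_div (a := M) hd (Or.inr hM)
    simpa using this
  refine tendsto_of_tendsto_of_tendsto_of_le_of_le' tendsto_const_nhds hq
    (Eventually.of_forall fun _ => zero_le) ?_
  filter_upwards [hd.eventually_ne ENNReal.top_ne_zero] with j hj
  rw [ENNReal.le_div_iff_mul_le (Or.inl hj) (Or.inl ENNReal.ofReal_ne_top), mul_comm]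
  exact (ofReal_mul_measure_sublevel_le hΩ hFV hS hg (hε j) hδ (hum j) (hhu j) (G j)).trans (hE j)

lemma integral_norm_eq_integral_add_negPart {Ω : Set (EuclideanSpace ℝ (Fin n))}
    {u : EuclideanSpace ℝ (Fin n) → ℝ} (hu : Integrable u) :
    ∫ x in Ω, ‖u x‖ = (∫ x in Ω, u x) + 2 * ∫ x in Ω, ‖min (u x) 0‖ := by
  have hmin : Integrable (fun x => min (u x) 0) := hu.inf (integrable_zero _ _ _)
  rw [← integral_const_mul, ← integral_add hu.integrableOn
    ((hmin.norm.const_mul 2).integrableOn)]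
  refine integral_congr_ae (ae_of_all _ fun x => ?_)
  rcases le_total 0 (u x) with h | h
  · simp [h, abs_of_nonneg]
  · simp only [Real.norm_eq_abs, min_eq_left h, abs_of_nonpos h]
    ring

end ThinFilm

theorem mainTheorem3 (n : ℕ) (hn : 1 ≤ n)
    (Ω : Set (EuclideanSpace ℝ (Fin n))) (hΩo : IsOpen Ω) (hΩb : Bornology.IsBounded Ω)
    (hΩL : ThinFilm.HasLipschitzBoundary Ω)
    (γFV γVS γFS : ℝ) (hFV : 0 < γFV) (hVS : 0 < γVS) (hFS : 0 < γFS)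
    (θ : ℝ) (hθ : θ ∈ Set.Ioo 0 (Real.pi / 2)) (hYoung : Real.cos θ = (γVS - γFS) / γFV)
    (V : ℝ) (hV : 0 < V)
    (g : ℝ → ℝ) (hg : ThinFilm.IsInterpolation g)
    (ε : ℕ → ℝ) (hε : ∀ j, 0 < ε j) (hε0 : Filter.Tendsto ε Filter.atTop (nhds 0))
    (h : ℕ → EuclideanSpace ℝ (Fin n) → ℝ) (hW : ∀ j, ThinFilm.MemW11 Ω (h j))
    (hM : ⨆ j, ThinFilm.energy Ω γFV γVS γFS V g (ε j) (h j) < ⊤) :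
    ∃ (k : ℕ → ℕ) (u : EuclideanSpace ℝ (Fin n) → ℝ), StrictMono k ∧
      ThinFilm.MemBV Ω u ∧
      Filter.Tendsto
        (fun m => MeasureTheory.eLpNorm (h (k m) - u) 1 (MeasureTheory.volume.restrict Ω))
        Filter.atTop (nhds 0) ∧
      ∫ x in Ω, u x = V ∧
      ∀ᵐ x ∂(MeasureTheory.volume.restrict Ω), 0 ≤ u x := by
  have hcos0 : 0 < Real.cos θ :=
    Real.cos_pos_of_mem_Ioo ⟨by linarith [hθ.1, Real.pi_pos], hθ.2⟩
  have hcos1 : Real.cos θ < 1 := by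
    rw [← Real.cos_zero]
    exact Real.cos_lt_cos_of_nonneg_of_le_pi_div_two le_rfl hθ.2.le hθ.1
  have hprod : γVS - γFS = Real.cos θ * γFV := by
    rw [hYoung, div_mul_cancel₀ _ hFV.ne']
  have ha : 0 < γVS - γFS := by rw [hprod]; positivity
  have hS : ThinFilm.spreading γFV γVS γFS < 0 := by
    unfold ThinFilm.spreading
    rw [hprod]
    nlinarith
  set M := ⨆ j, ThinFilm.energy Ω γFV γVS γFS V g (ε j) (h j) with hMdef
  have hEj : ∀ j, ThinFilm.energy Ω γFV γVS γFS V g (ε j) (h j) ≤ M := fun j =>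
    le_iSup (fun j => ThinFilm.energy Ω γFV γVS γFS V g (ε j) (h j)) j
  have hint : ∀ j, ∫ x in Ω, h j x = V := by
    intro j
    by_contra hne
    have h1 := (hEj j).trans_lt hM
    rw [ThinFilm.energy, if_neg fun h' => hne h'.2] at h1
    exact lt_irrefl _ h1
  have hE : ∀ j, ∫⁻ x in Ω, ENNReal.ofReal (ThinFilm.density γFV γVS γFS g (ε j) (h j x)
      * Real.sqrt (1 + ‖ThinFilm.weakGradient Ω (h j) x‖ ^ 2)) ≤ M := by
    intro j
    have h1 := hEj j
    rwa [ThinFilm.energy, if_pos ⟨hW j, hint j⟩] at h1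
  have hG : ∀ j, IntegrableOn (ThinFilm.weakGradient Ω (h j)) Ω := fun j =>
    (hW j).weakGradient_spec.1
  -- the gradients are bounded in `L¹` because the density is at least `γ_VS - γ_FS > 0`
  have hC : ∀ j, ∫ x in Ω, ‖ThinFilm.weakGradient Ω (h j) x‖
      ≤ (M / ENNReal.ofReal (γVS - γFS)).toReal := by
    intro j
    have ha' : ENNReal.ofReal (γVS - γFS) ≠ 0 := (ENNReal.ofReal_pos.2 ha).ne'
    rw [integral_norm_eq_lintegral_enorm (hG j).aestronglyMeasurable]
    refine ENNReal.toReal_mono (ENNReal.div_ne_top hM.ne ha') ?_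
    rw [ENNReal.le_div_iff_mul_le (Or.inl ha') (Or.inl ENNReal.ofReal_ne_top), mul_comm]
    exact (ThinFilm.mul_lintegral_weakGradient_le hS ha hg (ε j) (h j) _).trans (hE j)
  choose u hum hui hu0 hhu hw using fun j => (hW j).exists_representative hΩo
  have hlevel : ∀ δ > 0, Tendsto (fun j => volume {x ∈ Ω | u j x < -δ}) atTop (𝓝 0) :=
    fun δ hδ => ThinFilm.tendsto_measure_sublevel hΩo hFV hS hg hε hε0 hum hhu _ hM.ne hE hδ
  have hintu : ∀ j, ∫ x in Ω, u j x = V := fun j =>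
    (integral_congr_ae (hhu j)).symm.trans (hint j)
  obtain ⟨L, hL, hLev⟩ := ThinFilm.exists_bound_lintegral_negPart hΩo hΩb hΩL hum hui hG hw hC
    (hlevel 1 one_pos)
  -- the `L¹` bound holds from the index `N` on, so the sequence is shifted by `N`
  obtain ⟨N, hN⟩ := eventually_atTop.1 hLev
  have hbound : ∀ j, ∫ x, ‖u (j + N) x‖ ≤ V + 2 * L.toReal := by
    intro j
    have hmin : Integrable (fun x => min (u (j + N) x) 0) :=
      (hui (j + N)).inf (integrable_zero _ _ _)
    rw [← setIntegral_eq_integral_of_forall_compl_eq_zero (s := Ω)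
        fun x hx => by rw [hu0 _ x hx, norm_zero],
      ThinFilm.integral_norm_eq_integral_add_negPart (hui _), hintu]
    gcongr
    rw [integral_norm_eq_lintegral_enorm hmin.integrableOn.aestronglyMeasurable]
    exact ENNReal.toReal_mono hL (hN _ (Nat.le_add_left _ _))
  obtain ⟨k, hk, hcauchy⟩ := ThinFilm.exists_subseq_isL1CauchyOn_of_isWeakGradient hΩo hΩb hΩL
    (u := fun j => u (j + N)) (fun j => hum _) (fun j => hui _) hbound (fun j => hG _)
    (fun j => hw _) (fun j => hC _)
  obtain ⟨v, hv, hlim⟩ := hcauchy.exists_tendsto fun j => (hui _).integrableOn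
  have hkN : StrictMono fun m => k m + N := fun i j hij => Nat.add_lt_add_right (hk hij) N
  refine ⟨fun m => k m + N, v, hkN, ?_, ?_, ?_, ?_⟩
  · exact ThinFilm.memBV_of_tendsto hΩo hΩb (fun j => (hui _).integrableOn) (fun j => hG _)
      (fun j => hw _) (fun j => hC _) hv hlim
  · exact hlim.congr fun m => eLpNorm_congr_ae ((hhu _).symm.sub EventuallyEq.rfl)
  · have h1 := tendsto_integral_of_L1' v hv.aestronglyMeasurable
      (Eventually.of_forall fun j => (hui (k j + N)).integrableOn) hlim
    refine tendsto_nhds_unique h1 ?_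
    simp [hintu]
  · exact ThinFilm.ae_nonneg_of_tendsto hΩo (fun j => (hui _).integrableOn) hv hlim
      fun δ hδ => (hlevel δ hδ).comp hkN.tendsto_atTop
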